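/- **Conventions and systems.** *$\mathsf{HAP}$* is a single-sorted theory in the intuitionistic logic of partial terms. Here $t\downarrow$ abbreviates $t=t$, $s\simeq t$ abbreviates $(s\downarrow\lor\, t\downarrow)\to s=t$, and $\lnot\varphi$ abbreviates $\varphi\to\bot$. The connectives obey the usual intuitionistic laws. The quantifier laws are $\forall x\,\varphi\land t\downarrow\to\varphi[t/x]$ and $\varphi[t/x]\land t\downarrow\to\exists x\,\varphi$, with the usual introduction rule for $\forall$ and elimination rule for $\exists$. Equality is an equivalence relation on existing objects and a congruence for the function symbols. Constants denote, and function symbols and equality are strict: if $F(\vec t)\downarrow$ then all $t_i\downarrow$, and if $s=t$ then $s\downarrow$ and $t\downarrow$. The language has $0,S,+,\times$, a binary application $x\cdot y$ (written $xy$, associating to the left), and constants $\mathbf k,\mathbf s,\mathbf p,\mathbf p_0,\mathbf p_1,\mathbf{succ},\mathbf r$. The axioms are: - $Sx\downarrow$, $x+y\downarrow$, $x\times y\downarrow$, $Sx=Sy\to x=y$, $\lnot\,0=Sx$, $x+0=x$, $x+Sy=S(x+y)$, $x\times 0=0$, $x\times Sy=(x\times y)+x$; - $\mathbf kxy=x$,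 $\mathbf sxy\downarrow$, $\mathbf sxyz\simeq xz(yz)$, $\mathbf p_0x\downarrow$, $\mathbf p_1x\downarrow$, $\mathbf p_0(\mathbf pxy)=x$, $\mathbf p_1(\mathbf pxy)=y$, $\mathbf p(\mathbf p_0x)(\mathbf p_1x)=x$, $\mathbf{succ}\cdot x=Sx$, $\mathbf rxy0=x$, $\mathbf rxy(Sz)\simeq yz(\mathbf rxyz)$; - induction $\varphi[0/x]\land\forall x(\varphi\to\varphi[Sx/x])\to\forall x\,\varphi$ for all formulas $\varphi$. *$\mathsf{HA}^\omega$.* The finite types are generated from $0$ by $\sigma\to\tau$ and $\sigma\times\tau$. $\mathsf{HA}^\omega$ is formulated in many-sorted intuitionistic logic with these types as sorts. Its terms are built by well-typed application from typed variables and the constants $\mathbf k,\mathbf s,\mathbf p,\mathbf p_0,\mathbf p_1$ at all appropriate types, $0$ of type $0$, $S$ of type $0\to 0$, and recursors $\mathbf R^\sigma$ of type $\sigma\to((0\to(\sigma\to\sigma))\to(0\to\sigma))$. Its atomic formulas are $\bot$ and $s=_\sigma t$, with equality primitive at every type. Its axioms are: equality is an equivalence relation at all types; $f=g\to fx=gx$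 and $x=y\to fx=fy$; $\lnot Sx=0$ and $Sx=Sy\to x=y$; full induction; and the equations $\mathbf kxy=x$, $\mathbf sxyz=xz(yz)$, $\mathbf p_0(\mathbf pxy)=x$, $\mathbf p_1(\mathbf pxy)=y$, $\mathbf p(\mathbf p_0x)(\mathbf p_1x)=x$, $\mathbf Rxy0=x$, $\mathbf Rxy(Sn)=yn(\mathbf Rxyn)$. *$\mathsf{E\text{-}HA}^\omega+\mathsf{AC}$* is $\mathsf{HA}^\omega$ together with, for all types $\sigma,\tau$, extensionality $\forall f,g^{\sigma\to\tau}\,(\forall x^\sigma\,fx=_\tau gx\to f=_{\sigma\to\tau}g)$ and all instances of $\forall x^\sigma\exists y^\tau\varphi(x,y,\vec z)\to\exists f^{\sigma\to\tau}\forall x^\sigma\varphi(x,fx,\vec z)$. **The relations $\sim_\sigma$.** In $\mathsf{HAP}$ define, by induction on $\sigma$: - $x\sim_0y:\equiv x=y$; - $x\sim_{\sigma\times\tau}y:\equiv\mathbf p_0x\sim_\sigma\mathbf p_0y\land\mathbf p_1x\sim_\tau\mathbf p_1y$; - $x\sim_{\sigma\to\tau}y:\equiv\forall z,z'\,(z\sim_\sigma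 z'\to xz\downarrow\land\, xz'\downarrow\land\, yz\downarrow\land\, yz'\downarrow\land\, xz\sim_\tau xz'\land yz\sim_\tau yz'\land xz\sim_\tau yz)$. Put $\mathrm{HEO}_\sigma(x):\equiv x\sim_\sigma x$. **Extensional realizability.** Read $\mathsf{HA}^\omega$-terms as $\mathsf{HAP}$-terms by forgetting types, with $\mathbf r$ for $\mathbf R$ and $\mathbf{succ}$ for the constant $S$. For atomic $\varphi$ let $\varphi^*$ be $\varphi$ with $=_\sigma$ read as $\sim_\sigma$ and $\bot$ as $\bot$. For each $\mathsf{HA}^\omega$-formula $\varphi$ the $\mathsf{HAP}$-formulas $x\,\mathsf e\,\varphi$ and $x=x'\,\mathsf e\,\varphi$ are defined by simultaneous induction: - $\varphi$ atomic: $x\,\mathsf e\,\varphi:\equiv\varphi^*$, and $x=x'\,\mathsf e\,\varphi:\equiv\varphi^*\land x=x'$. - $x\,\mathsf e\,(\varphi\land\psi):\equiv\mathbf p_0x\,\mathsf e\,\varphi\land\mathbf p_1x\,\mathsf e\,\psi$, and $x=x'\,\mathsf e\,(\varphi\land\psi):\equiv\mathbf p_0x=\mathbf p_0x'\,\mathsf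 e\,\varphi\land\mathbf p_1x=\mathbf p_1x'\,\mathsf e\,\psi$. - $x\,\mathsf e\,(\varphi\to\psi):\equiv\forall y,y'\,(y=y'\,\mathsf e\,\varphi\to xy\downarrow\land\,xy'\downarrow\land\,xy=xy'\,\mathsf e\,\psi)$, and $x=x'\,\mathsf e\,(\varphi\to\psi):\equiv x\,\mathsf e\,(\varphi\to\psi)\land x'\,\mathsf e\,(\varphi\to\psi)\land\forall y\,(y\,\mathsf e\,\varphi\to xy=x'y\,\mathsf e\,\psi)$. - $x\,\mathsf e\,\forall y^\sigma\varphi:\equiv\forall y,y'\,(y\sim_\sigma y'\to xy\downarrow\land\,xy'\downarrow\land\,xy=xy'\,\mathsf e\,\varphi)$, and $x=x'\,\mathsf e\,\forall y^\sigma\varphi:\equiv x\,\mathsf e\,\forall y^\sigma\varphi\land x'\,\mathsf e\,\forall y^\sigma\varphi\land\forall y\,(\mathrm{HEO}_\sigma(y)\to xy=x'y\,\mathsf e\,\varphi)$. - $x\,\mathsf e\,\exists y^\sigma\varphi:\equiv\mathrm{HEO}_\sigma(\mathbf p_0x)\land(\mathbf p_1x\,\mathsf e\,\varphi)[\mathbf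 p_0x/y]$, and $x=x'\,\mathsf e\,\exists y^\sigma\varphi:\equiv(\mathbf p_1x=\mathbf p_1x'\,\mathsf e\,\varphi)[\mathbf p_0x/y]\land\mathbf p_0x\sim_\sigma\mathbf p_0x'$. - A disjunction $\varphi\lor\psi$ is treated as $\exists n^0\,((n=0\to\varphi)\land(\lnot\,n=0\to\psi))$ with $n$ fresh. **Theorem.** Let $\varphi$ be an $\mathsf{HA}^\omega$-formula with free variables among the distinct variables $y_1^{\sigma_1},\dots,y_n^{\sigma_n}$ ($n\ge 0$). If $\mathsf{E\text{-}HA}^\omega+\mathsf{AC}\vdash\varphi$, then $$\mathsf{HAP}\vdash\exists x\,\forall y_1,\dots,y_n\,\big(\mathrm{HEO}_{\sigma_1}(y_1)\land\dots\land\mathrm{HEO}_{\sigma_n}(y_n)\to (x\cdot y_1\cdots y_n)\downarrow\;\land\; x\cdot y_1\cdots y_n\,\mathsf e\,\varphi\big).$$ -/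

import Mathlib

/-! # The single-sorted theory `HAP` over the logic of partial terms -/

namespace HAP

/-- The constants of the language. -/
inductive Const : Type
  | zero | k | s | p | p0 | p1 | succ | r

/-- The binary function symbols: addition, multiplication, application. -/
inductive BinOp : Type
  | add | mul | app

/-- Terms, with de Bruijn indices as variables. -/
inductive Term : Type
  | var (n : ℕ)
  | const (c : Const)
  | S (t : Term)
  | bin (o : BinOp) (t u : Term)

namespace Term

abbrev zero : Term := const .zero
abbrev add (t u : Term) : Term := bin .add t u
abbrev mul (t u : Term) : Term := bin .mul t u
/-- Application `t · u`. -/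
abbrev app (t u : Term) : Term := bin .app t u
/-- The term `p₀ · t`. -/
abbrev fst (t : Term) : Term := app (const .p0) t
/-- The term `p₁ · t`. -/
abbrev snd (t : Term) : Term := app (const .p1) t

/-- Simultaneous substitution. -/
def subst (f : ℕ → Term) : Term → Term
  | var n => f n
  | const c => const c
  | S t => S (t.subst f)
  | bin o t u => bin o (t.subst f) (u.subst f)

/-- Renaming of every variable `n` to `n + 1`. -/
def shift (t : Term) : Term := t.subst (fun n => var (n + 1))

end Term

/-- The substitution sending variable `0` to `t` and variable `n + 1` to `f n`. -/
def scons (t : Term) (f : ℕ → Term) : ℕ → Term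
  | 0 => t
  | n + 1 => f n

/-- Weaken all the values of a substitution. -/
def shiftSub (f : ℕ → Term) : ℕ → Term := fun n => (f n).shift

/-- Formulas. The quantifiers bind de Bruijn index `0`. -/
inductive Formula : Type
  | bot
  | eq (t u : Term)
  | and (φ ψ : Formula)
  | or (φ ψ : Formula)
  | imp (φ ψ : Formula)
  | all (φ : Formula)
  | ex (φ : Formula)

namespace Formula

abbrev top : Formula := imp bot bot
abbrev neg (φ : Formula) : Formula := imp φ bot
/-- `t ↓`, i.e. `t = t`. -/
abbrev dn (t : Term) : Formula := eq t t
/-- `t ≃ u`, i.e. `(t ↓ ∨ u ↓) → t = u`. -/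
abbrev keq (t u : Term) : Formula := imp (or (dn t) (dn u)) (eq t u)

/-- Capture-avoiding simultaneous substitution. -/
def subst : (ℕ → Term) → Formula → Formula
  | _, bot => bot
  | f, eq t u => eq (t.subst f) (u.subst f)
  | f, and φ ψ => and (φ.subst f) (ψ.subst f)
  | f, or φ ψ => or (φ.subst f) (ψ.subst f)
  | f, imp φ ψ => imp (φ.subst f) (ψ.subst f)
  | f, all φ => all (φ.subst (scons (.var 0) (shiftSub f)))
  | f, ex φ => ex (φ.subst (scons (.var 0) (shiftSub f)))

/-- Weakening: the variable `0` does not occur in `φ.shift`. -/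
def shift (φ : Formula) : Formula := φ.subst (fun n => .var (n + 1))

/-- `φ[t/x]`, where `x` is the variable with index `0`. -/
def inst (φ : Formula) (t : Term) : Formula := φ.subst (scons t .var)

/-- A block of `n` universal quantifiers. -/
def allN : ℕ → Formula → Formula
  | 0, φ => φ
  | n + 1, φ => allN n (all φ)

end Formula

open Formula Term in
/-- Provability in `HAP`: intuitionistic logic of partial terms with strict function symbols and
equality, and the axioms for arithmetic, for the combinators, and full induction. -/
inductive Prov : Formula → Prop
  -- propositional logic
  | refl (φ) : Prov (imp φ φ)
  | mp {φ ψ} : Prov φ → Prov (imp φ ψ) → Prov ψ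
  | trans {φ ψ χ} : Prov (imp φ ψ) → Prov (imp ψ χ) → Prov (imp φ χ)
  | and_left (φ ψ) : Prov (imp (and φ ψ) φ)
  | and_right (φ ψ) : Prov (imp (and φ ψ) ψ)
  | and_intro {φ ψ χ} : Prov (imp φ ψ) → Prov (imp φ χ) → Prov (imp φ (and ψ χ))
  | or_left (φ ψ) : Prov (imp φ (or φ ψ))
  | or_right (φ ψ) : Prov (imp ψ (or φ ψ))
  | or_elim {φ ψ χ} : Prov (imp φ χ) → Prov (imp ψ χ) → Prov (imp (or φ ψ) χ)
  | curry {φ ψ χ} : Prov (imp (and φ ψ) χ) → Prov (imp φ (imp ψ χ))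
  | uncurry {φ ψ χ} : Prov (imp φ (imp ψ χ)) → Prov (imp (and φ ψ) χ)
  | bot_elim (φ) : Prov (imp bot φ)
  -- quantifiers, which range over existing objects
  | all_intro {φ ψ} : Prov (imp φ.shift ψ) → Prov (imp φ (all ψ))
  | all_elim (φ t) : Prov (imp (and (all φ) (dn t)) (φ.inst t))
  | ex_intro (φ t) : Prov (imp (and (φ.inst t) (dn t)) (ex φ))
  | ex_elim {φ ψ} : Prov (imp φ ψ.shift) → Prov (imp (ex φ) ψ)
  -- equality
  | eq_refl : Prov (all (eq (var 0) (var 0)))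
  | eq_symm : Prov (all (all (imp (eq (var 1) (var 0)) (eq (var 0) (var 1)))))
  | eq_trans : Prov (all (all (all
      (imp (and (eq (var 2) (var 1)) (eq (var 1) (var 0))) (eq (var 2) (var 0))))))
  | eq_S : Prov (all (all
      (imp (and (eq (var 1) (var 0)) (dn (S (var 1)))) (eq (S (var 1)) (S (var 0))))))
  | eq_bin (o) : Prov (all (all (all (all
      (imp (and (and (eq (var 3) (var 1)) (eq (var 2) (var 0))) (dn (bin o (var 3) (var 2))))
        (eq (bin o (var 3) (var 2)) (bin o (var 1) (var 0))))))))
  -- strictness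
  | strict_const (c) : Prov (dn (const c))
  | strict_S (t) : Prov (imp (dn (S t)) (dn t))
  | strict_bin_left (o t u) : Prov (imp (dn (bin o t u)) (dn t))
  | strict_bin_right (o t u) : Prov (imp (dn (bin o t u)) (dn u))
  | strict_eq (t u) : Prov (imp (eq t u) (and (dn t) (dn u)))
  -- arithmetic; `i`, `j` stand for variables
  | S_dn (i) : Prov (dn (S (var i)))
  | add_dn (i j) : Prov (dn (add (var i) (var j)))
  | mul_dn (i j) : Prov (dn (mul (var i) (var j)))
  | S_inj (i j) : Prov (imp (eq (S (var i)) (S (var j))) (eq (var i) (var j)))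
  | zero_ne_S (i) : Prov (neg (eq zero (S (var i))))
  | add_zero (i) : Prov (eq (add (var i) zero) (var i))
  | add_S (i j) : Prov (eq (add (var i) (S (var j))) (S (add (var i) (var j))))
  | mul_zero (i) : Prov (eq (mul (var i) zero) zero)
  | mul_S (i j) : Prov (eq (mul (var i) (S (var j))) (add (mul (var i) (var j)) (var i)))
  -- combinators; `i`, `j`, `l` stand for variables
  | k_eq (i j) : Prov (eq (app (app (const .k) (var i)) (var j)) (var i))
  | s_dn (i j) : Prov (dn (app (app (const .s) (var i)) (var j)))
  | s_eq (i j l) : Prov (keq (app (app (app (const .s) (var i)) (var j)) (var l))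
      (app (app (var i) (var l)) (app (var j) (var l))))
  | p0_dn (i) : Prov (dn (fst (var i)))
  | p1_dn (i) : Prov (dn (snd (var i)))
  | p0_eq (i j) : Prov (eq (fst (app (app (const .p) (var i)) (var j))) (var i))
  | p1_eq (i j) : Prov (eq (snd (app (app (const .p) (var i)) (var j))) (var j))
  | p_eq (i) : Prov (eq (app (app (const .p) (fst (var i))) (snd (var i))) (var i))
  | succ_eq (i) : Prov (eq (app (const .succ) (var i)) (S (var i)))
  | r_zero (i j) : Prov (eq (app (app (app (const .r) (var i)) (var j)) zero) (var i))
  | r_S (i j l) : Prov (keq (app (app (app (const .r) (var i)) (var j)) (S (var l)))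
      (app (app (var j) (var l)) (app (app (app (const .r) (var i)) (var j)) (var l))))
  -- induction
  | ind (φ : Formula) : Prov (imp
      (and (φ.inst zero) (all (imp φ (φ.subst (scons (S (var 0)) (fun n => var (n + 1)))))))
      (all φ))

end HAP

/-! # Intuitionistic arithmetic in all finite types -/

namespace HAomega

/-- The finite types. -/
inductive Ty : Type
  | nat
  | arrow (σ τ : Ty)
  | prod (σ τ : Ty)

/-- Contexts: the types of the variables that may occur free, the last variable first. -/
abbrev Ctx : Type := List Ty

/-- Typed de Bruijn variables. -/
inductive Var : Ctx → Ty → Type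
  | here {Γ σ} : Var (σ :: Γ) σ
  | there {Γ σ τ} : Var Γ σ → Var (τ :: Γ) σ

/-- The position of a variable in its context. -/
def Var.toNat {Γ : Ctx} {σ : Ty} : Var Γ σ → ℕ
  | .here => 0
  | .there v => v.toNat + 1

/-- Typed terms. -/
inductive Term (Γ : Ctx) : Ty → Type
  | var {σ} (v : Var Γ σ) : Term Γ σ
  | k (σ τ) : Term Γ (.arrow σ (.arrow τ σ))
  | s (ρ σ τ) : Term Γ
      (.arrow (.arrow ρ (.arrow σ τ)) (.arrow (.arrow ρ σ) (.arrow ρ τ)))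
  | p (ρ σ) : Term Γ (.arrow ρ (.arrow σ (.prod ρ σ)))
  | p0 (ρ σ) : Term Γ (.arrow (.prod ρ σ) ρ)
  | p1 (ρ σ) : Term Γ (.arrow (.prod ρ σ) σ)
  | zero : Term Γ .nat
  | S : Term Γ (.arrow .nat .nat)
  | R (σ) : Term Γ (.arrow σ (.arrow (.arrow .nat (.arrow σ σ)) (.arrow .nat σ)))
  | app {σ τ} (f : Term Γ (.arrow σ τ)) (x : Term Γ σ) : Term Γ τ

/-- Substitutions of terms over `Δ` for the variables of `Γ`. -/
abbrev Sub (Γ Δ : Ctx) : Type := ∀ σ : Ty, Var Γ σ → Term Δ σ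

def Term.subst {Γ Δ : Ctx} (f : Sub Γ Δ) : {σ : Ty} → Term Γ σ → Term Δ σ
  | _, .var v => f _ v
  | _, .k σ τ => .k σ τ
  | _, .s ρ σ τ => .s ρ σ τ
  | _, .p ρ σ => .p ρ σ
  | _, .p0 ρ σ => .p0 ρ σ
  | _, .p1 ρ σ => .p1 ρ σ
  | _, .zero => .zero
  | _, .S => .S
  | _, .R σ => .R σ
  | _, .app t u => .app (t.subst f) (u.subst f)

/-- The substitution weakening every variable past a new one. -/
def wkSub (Γ : Ctx) (τ : Ty) : Sub Γ (τ :: Γ) := fun _ v => .var (.there v)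

/-- The substitution sending the newest variable to `t` and the others as `f` does. -/
def scons {Γ Δ : Ctx} {τ : Ty} (t : Term Δ τ) (f : Sub Γ Δ) : Sub (τ :: Γ) Δ
  | _, .here => t
  | _, .there v => f _ v

/-- The extension of a substitution under a binder. -/
def up {Γ Δ : Ctx} (τ : Ty) (f : Sub Γ Δ) : Sub (τ :: Γ) (τ :: Δ) :=
  scons (.var .here) (fun σ v => (f σ v).subst (wkSub Δ τ))

/-- Formulas in context. -/
inductive Formula : Ctx → Type
  | bot {Γ} : Formula Γ
  | eq {Γ} (σ : Ty) (t u : Term Γ σ) : Formula Γ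
  | and {Γ} (φ ψ : Formula Γ) : Formula Γ
  | or {Γ} (φ ψ : Formula Γ) : Formula Γ
  | imp {Γ} (φ ψ : Formula Γ) : Formula Γ
  | all {Γ} (σ : Ty) (φ : Formula (σ :: Γ)) : Formula Γ
  | ex {Γ} (σ : Ty) (φ : Formula (σ :: Γ)) : Formula Γ

namespace Formula

abbrev neg {Γ : Ctx} (φ : Formula Γ) : Formula Γ := imp φ bot

/-- Capture-avoiding simultaneous substitution. -/
def subst : {Γ Δ : Ctx} → Sub Γ Δ → Formula Γ → Formula Δ
  | _, _, _, bot => bot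
  | _, _, f, eq σ t u => eq σ (t.subst f) (u.subst f)
  | _, _, f, and φ ψ => and (φ.subst f) (ψ.subst f)
  | _, _, f, or φ ψ => or (φ.subst f) (ψ.subst f)
  | _, _, f, imp φ ψ => imp (φ.subst f) (ψ.subst f)
  | _, _, f, all σ φ => all σ (φ.subst (up σ f))
  | _, _, f, ex σ φ => ex σ (φ.subst (up σ f))

/-- Weakening by a fresh variable of type `τ`. -/
def wk {Γ : Ctx} (τ : Ty) (φ : Formula Γ) : Formula (τ :: Γ) := φ.subst (wkSub Γ τ)

/-- Substitution of `t` for the newest variable. -/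
def inst {Γ : Ctx} {τ : Ty} (φ : Formula (τ :: Γ)) (t : Term Γ τ) : Formula Γ :=
  φ.subst (scons t (fun _ v => .var v))

end Formula

open Formula in
/-- Provability in intuitionistic finite type arithmetic extended by the axioms `Ax`.
`Prov Ax φ` for `φ : Formula Γ` says that `φ` has a derivation; since every type contains a closed
term, it does not matter that derivations name their free variables in contexts. -/
inductive Prov (Ax : ∀ Γ : Ctx, Formula Γ → Prop) : {Γ : Ctx} → Formula Γ → Prop
  | ax {Γ} {φ : Formula Γ} : Ax Γ φ → Prov Ax φ
  -- many-sorted intuitionistic logic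
  | refl {Γ} (φ : Formula Γ) : Prov Ax (imp φ φ)
  | mp {Γ} {φ ψ : Formula Γ} : Prov Ax φ → Prov Ax (imp φ ψ) → Prov Ax ψ
  | trans {Γ} {φ ψ χ : Formula Γ} :
      Prov Ax (imp φ ψ) → Prov Ax (imp ψ χ) → Prov Ax (imp φ χ)
  | and_left {Γ} (φ ψ : Formula Γ) : Prov Ax (imp (and φ ψ) φ)
  | and_right {Γ} (φ ψ : Formula Γ) : Prov Ax (imp (and φ ψ) ψ)
  | and_intro {Γ} {φ ψ χ : Formula Γ} :
      Prov Ax (imp φ ψ) → Prov Ax (imp φ χ) → Prov Ax (imp φ (and ψ χ))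
  | or_left {Γ} (φ ψ : Formula Γ) : Prov Ax (imp φ (or φ ψ))
  | or_right {Γ} (φ ψ : Formula Γ) : Prov Ax (imp ψ (or φ ψ))
  | or_elim {Γ} {φ ψ χ : Formula Γ} :
      Prov Ax (imp φ χ) → Prov Ax (imp ψ χ) → Prov Ax (imp (or φ ψ) χ)
  | curry {Γ} {φ ψ χ : Formula Γ} : Prov Ax (imp (and φ ψ) χ) → Prov Ax (imp φ (imp ψ χ))
  | uncurry {Γ} {φ ψ χ : Formula Γ} : Prov Ax (imp φ (imp ψ χ)) → Prov Ax (imp (and φ ψ) χ)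
  | bot_elim {Γ} (φ : Formula Γ) : Prov Ax (imp bot φ)
  | all_intro {Γ} {σ : Ty} {φ : Formula Γ} {ψ : Formula (σ :: Γ)} :
      Prov Ax (imp (φ.wk σ) ψ) → Prov Ax (imp φ (all σ ψ))
  | all_elim {Γ} {σ : Ty} (φ : Formula (σ :: Γ)) (t : Term Γ σ) :
      Prov Ax (imp (all σ φ) (φ.inst t))
  | ex_intro {Γ} {σ : Ty} (φ : Formula (σ :: Γ)) (t : Term Γ σ) :
      Prov Ax (imp (φ.inst t) (ex σ φ))
  | ex_elim {Γ} {σ : Ty} {φ : Formula (σ :: Γ)} {ψ : Formula Γ} :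
      Prov Ax (imp φ (ψ.wk σ)) → Prov Ax (imp (ex σ φ) ψ)
  -- equality at all types
  | eq_refl {Γ} {σ : Ty} (x : Term Γ σ) : Prov Ax (eq σ x x)
  | eq_symm {Γ} {σ : Ty} (x y : Term Γ σ) : Prov Ax (imp (eq σ x y) (eq σ y x))
  | eq_trans {Γ} {σ : Ty} (x y z : Term Γ σ) :
      Prov Ax (imp (and (eq σ x y) (eq σ y z)) (eq σ x z))
  | eq_fun {Γ} {σ τ : Ty} (f g : Term Γ (.arrow σ τ)) (x : Term Γ σ) :
      Prov Ax (imp (eq (.arrow σ τ) f g) (eq τ (.app f x) (.app g x)))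
  | eq_arg {Γ} {σ τ : Ty} (f : Term Γ (.arrow σ τ)) (x y : Term Γ σ) :
      Prov Ax (imp (eq σ x y) (eq τ (.app f x) (.app f y)))
  -- successor and induction
  | S_ne_zero {Γ} (x : Term Γ .nat) : Prov Ax (neg (eq .nat (.app .S x) .zero))
  | S_inj {Γ} (x y : Term Γ .nat) :
      Prov Ax (imp (eq .nat (.app .S x) (.app .S y)) (eq .nat x y))
  | ind {Γ} (φ : Formula (.nat :: Γ)) :
      Prov Ax (imp (φ.inst .zero)
        (imp (all .nat (imp φ (φ.subst (scons (.app .S (.var .here)) (wkSub Γ .nat)))))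
          (all .nat φ)))
  -- combinators and recursor
  | k_eq {Γ} {σ τ : Ty} (x : Term Γ σ) (y : Term Γ τ) :
      Prov Ax (eq σ (.app (.app (.k σ τ) x) y) x)
  | s_eq {Γ} {ρ σ τ : Ty} (x : Term Γ (.arrow ρ (.arrow σ τ))) (y : Term Γ (.arrow ρ σ))
      (z : Term Γ ρ) :
      Prov Ax (eq τ (.app (.app (.app (.s ρ σ τ) x) y) z) (.app (.app x z) (.app y z)))
  | p0_eq {Γ} {ρ σ : Ty} (x : Term Γ ρ) (y : Term Γ σ) :
      Prov Ax (eq ρ (.app (.p0 ρ σ) (.app (.app (.p ρ σ) x) y)) x)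
  | p1_eq {Γ} {ρ σ : Ty} (x : Term Γ ρ) (y : Term Γ σ) :
      Prov Ax (eq σ (.app (.p1 ρ σ) (.app (.app (.p ρ σ) x) y)) y)
  | p_eq {Γ} {ρ σ : Ty} (x : Term Γ (.prod ρ σ)) :
      Prov Ax (eq (.prod ρ σ)
        (.app (.app (.p ρ σ) (.app (.p0 ρ σ) x)) (.app (.p1 ρ σ) x)) x)
  | R_zero {Γ} {σ : Ty} (x : Term Γ σ) (y : Term Γ (.arrow .nat (.arrow σ σ))) :
      Prov Ax (eq σ (.app (.app (.app (.R σ) x) y) .zero) x)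
  | R_S {Γ} {σ : Ty} (x : Term Γ σ) (y : Term Γ (.arrow .nat (.arrow σ σ))) (n : Term Γ .nat) :
      Prov Ax (eq σ (.app (.app (.app (.R σ) x) y) (.app .S n))
        (.app (.app y n) (.app (.app (.app (.R σ) x) y) n)))

open Formula in
/-- The extensionality axioms `∀ f g, (∀ x, f x = g x) → f = g` and all instances
`∀ x, ∃ y, φ(x, y) → ∃ f, ∀ x, φ(x, f x)` of the axiom of choice. -/
inductive ExtAC : ∀ Γ : Ctx, Formula Γ → Prop
  | ext {Γ} (σ τ : Ty) : ExtAC Γ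
      (all (.arrow σ τ) (all (.arrow σ τ)
        (imp
          (all σ (eq τ (.app (.var (.there (.there .here))) (.var .here))
            (.app (.var (.there .here)) (.var .here))))
          (eq (.arrow σ τ) (.var (.there .here)) (.var .here)))))
  | ac {Γ} (σ τ : Ty) (φ : Formula (τ :: σ :: Γ)) : ExtAC Γ
      (imp (all σ (ex τ φ))
        (ex (.arrow σ τ) (all σ
          (φ.subst (scons (.app (.var (.there .here)) (.var .here))
            (scons (.var .here) (fun _ v => .var (.there (.there v)))))))))

end HAomega

/-! # Extensional realizability -/

namespace HEO

open HAomega (Ty Ctx)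
open HAP (shiftSub)
open HAP.Formula (dn)

/-- The relation `t ∼_σ u` as a formula of `HAP`. In the clause for function types
`z` is variable `1` and `z'` is variable `0`. -/
def sim : Ty → HAP.Term → HAP.Term → HAP.Formula
  | .nat, t, u => .eq t u
  | .prod σ τ, t, u => .and (sim σ t.fst u.fst) (sim τ t.snd u.snd)
  | .arrow σ τ, t, u =>
      let x := t.shift.shift
      let y := u.shift.shift
      let z : HAP.Term := .var 1
      let z' : HAP.Term := .var 0
      .all (.all (.imp (sim σ z z')
        (.and (dn (.app x z)) (.and (dn (.app x z')) (.and (dn (.app y z)) (.and (dn (.app y z'))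
          (.and (sim τ (.app x z) (.app x z')) (.and (sim τ (.app y z) (.app y z'))
            (sim τ (.app x z) (.app y z))))))))))

/-- `HEO_σ(t)`, i.e. `t ∼_σ t`. -/
def heo (σ : Ty) (t : HAP.Term) : HAP.Formula := sim σ t t

/-- The interpretation of typed terms: types are forgotten and combinators go to their untyped
counterparts. The variable at position `i` is replaced by `f i`. -/
def tm (f : ℕ → HAP.Term) {Γ : Ctx} : {σ : Ty} → HAomega.Term Γ σ → HAP.Term
  | _, .var v => f v.toNat
  | _, .k _ _ => .const .k
  | _, .s _ _ _ => .const .s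
  | _, .p _ _ => .const .p
  | _, .p0 _ _ => .const .p0
  | _, .p1 _ _ => .const .p1
  | _, .zero => .const .zero
  | _, .S => .const .succ
  | _, .R _ => .const .r
  | _, .app t u => .app (tm f t) (tm f u)

/-- The pair of `HAP`-formulas `x e φ` and `x = x' e φ` associated with a typed formula `φ`, with
`HAP`-terms substituted for `x`, `x'` and, through the first argument, for the free variables
of `φ`. -/
structure Interp : Type where
  real : (ℕ → HAP.Term) → HAP.Term → HAP.Formula
  same : (ℕ → HAP.Term) → HAP.Term → HAP.Term → HAP.Formula

namespace Interp

/-- Atomic formulas. -/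
def atom (A : (ℕ → HAP.Term) → HAP.Formula) : Interp where
  real f _ := A f
  same f x x' := .and (A f) (.eq x x')

/-- Conjunction. -/
def and (φ ψ : Interp) : Interp where
  real f x := .and (φ.real f x.fst) (ψ.real f x.snd)
  same f x x' := .and (φ.same f x.fst x'.fst) (ψ.same f x.snd x'.snd)

/-- `x e (φ → ψ)`; the bound variables `y`, `y'` have indices `1` and `0`. -/
def impReal (φ ψ : Interp) (f : ℕ → HAP.Term) (x : HAP.Term) : HAP.Formula :=
  let g := shiftSub (shiftSub f)
  let z := x.shift.shift
  .all (.all (.imp (φ.same g (.var 1) (.var 0))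
    (.and (dn (.app z (.var 1))) (.and (dn (.app z (.var 0)))
      (ψ.same g (.app z (.var 1)) (.app z (.var 0)))))))

/-- Implication. -/
def imp (φ ψ : Interp) : Interp where
  real f x := impReal φ ψ f x
  same f x x' := .and (impReal φ ψ f x) (.and (impReal φ ψ f x')
    (.all (.imp (φ.real (shiftSub f) (.var 0))
      (ψ.same (shiftSub f) (.app x.shift (.var 0)) (.app x'.shift (.var 0))))))

/-- `x e ∀ y^σ φ`; the bound variables `y`, `y'` have indices `1` and `0`. -/
def allReal (σ : Ty) (φ : Interp) (f : ℕ → HAP.Term) (x : HAP.Term) : HAP.Formula :=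
  let g := shiftSub (shiftSub f)
  let z := x.shift.shift
  .all (.all (.imp (sim σ (.var 1) (.var 0))
    (.and (dn (.app z (.var 1))) (.and (dn (.app z (.var 0)))
      (φ.same (HAP.scons (.var 1) g) (.app z (.var 1)) (.app z (.var 0)))))))

/-- Universal quantification over type `σ`. -/
def all (σ : Ty) (φ : Interp) : Interp where
  real f x := allReal σ φ f x
  same f x x' := .and (allReal σ φ f x) (.and (allReal σ φ f x')
    (.all (.imp (heo σ (.var 0))
      (φ.same (HAP.scons (.var 0) (shiftSub f)) (.app x.shift (.var 0)) (.app x'.shift (.var 0))))))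

/-- Existential quantification over type `σ`. -/
def ex (σ : Ty) (φ : Interp) : Interp where
  real f x := .and (heo σ x.fst) (φ.real (HAP.scons x.fst f) x.snd)
  same f x x' := .and (φ.same (HAP.scons x.fst f) x.snd x'.snd) (sim σ x.fst x'.fst)

/-- The same formula, regarded as one with an additional (dummy) first variable. -/
def wk (φ : Interp) : Interp where
  real f x := φ.real (fun n => f (n + 1)) x
  same f x x' := φ.same (fun n => f (n + 1)) x x'

/-- Disjunction, as the defined connective
`∃ n^0, (n = 0 → φ) ∧ (n ≠ 0 → ψ)`. -/
def or (φ ψ : Interp) : Interp :=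
  let isZero : Interp := atom (fun f => .eq (f 0) .zero)
  let falsum : Interp := atom (fun _ => .bot)
  ex .nat (and (imp isZero φ.wk) (imp (imp isZero falsum) ψ.wk))

end Interp

/-- Extensional realizability for typed formulas. -/
def interp : {Γ : Ctx} → HAomega.Formula Γ → Interp
  | _, .bot => .atom (fun _ => .bot)
  | _, .eq σ t u => .atom (fun f => sim σ (tm f t) (tm f u))
  | _, .and φ ψ => .and (interp φ) (interp ψ)
  | _, .or φ ψ => .or (interp φ) (interp ψ)
  | _, .imp φ ψ => .imp (interp φ) (interp ψ)
  | _, .all σ φ => .all σ (interp φ)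
  | _, .ex σ φ => .ex σ (interp φ)

/-- The formula `t e φ`, where the free variable of `φ` at position `i` is the `HAP`-variable
with index `i`. -/
def realizes (t : HAP.Term) {Γ : Ctx} (φ : HAomega.Formula Γ) : HAP.Formula :=
  (interp φ).real .var t

/-- The conjunction of the `HEO_σ(y)` over the variables `y`, with indices from `i` on, of a
context. -/
def heoCtx : Ctx → ℕ → HAP.Formula
  | [], _ => .top
  | σ :: Γ, i => .and (heoCtx Γ (i + 1)) (heo σ (.var i))

/-- For a context of length `n`, the term `x · y₁ · … · yₙ` in which `yₙ, …, y₁, x` are the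
variables with indices `i, …, i + n - 1, i + n`. -/
def appCtx : Ctx → ℕ → HAP.Term
  | [], i => .var i
  | _ :: Γ, i => .app (appCtx Γ (i + 1)) (.var i)

/-- The sentence `∃ x ∀ y₁ … yₙ (HEO(y₁) ∧ … ∧ HEO(yₙ) → x · y₁ ⋯ yₙ ↓ ∧ x · y₁ ⋯ yₙ e φ)`. -/
def realizable {Γ : Ctx} (φ : HAomega.Formula Γ) : HAP.Formula :=
  .ex (.allN Γ.length
    (.imp (heoCtx Γ 0) (.and (dn (appCtx Γ 0)) (realizes (appCtx Γ 0) φ))))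

end HEO

/-! The theorem is the soundness of a realizability whose realizers carry a partial equality. Every
axiom and rule of finite-type arithmetic gets a realizer that depends on the free variables only up
to `∼`. Extensionality is then realized because equality at a function type is read as `∼`, that is,
as sending related arguments to related values. Choice is realized because a realizer `a` of `∀ x ∃
y φ` must send related `x` to pairs with related first components, so `x ↦ p₀ (a x)` is itself an
object of HEO.

Derivations inside `HAP` are handled semantically. `H ⊩ φ` says that `H → φ` is provable, and the
formulas `H` serve as Kripke worlds: `ent_imp_iff` and `ent_all_iff` are the forcing clauses, and
`ent_ind` and `ent_nat_cases` give induction and case distinction. Bundling the relations with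
existence of both sides (`TyRel`, `Interp.rel`) turns the long defining clauses into those of a
logical relation over worlds: `TyRel.arrow_iff`, `Interp.rel_imp_iff` and `Interp.rel_all_iff` all
say that related arguments go to related values. On this basis `interp_good` proves that `x = x' e
φ` is a partial equivalence relation invariant under `∼` in the free variables, and `interp_subst`
is the substitution lemma.

Realizers are written as applicative polynomials. Bracket abstraction always denotes (`Poly.dn_lam`)
and obeys beta reduction as soon as the body denotes (`Poly.beta`). In `soundness` a realizer of a
formula in context is one closed term applied to a tuple of values of the variables; this keeps the
induction on derivations uniform when contexts grow and shrink. Only at the end is the tuple curried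
away, by `ent_appEnv_curried`. -/

namespace HAP

/-! ## Substitution -/

/-- The extension of a substitution under a binder. -/
abbrev up (f : ℕ → Term) : ℕ → Term := scons (.var 0) (shiftSub f)

@[simp] theorem scons_zero (t : Term) (f : ℕ → Term) : scons t f 0 = t := rfl

@[simp] theorem scons_succ (t : Term) (f : ℕ → Term) (n : ℕ) : scons t f (n + 1) = f n := rfl

@[simp] theorem scons_one (t : Term) (f : ℕ → Term) : scons t f 1 = f 0 := rfl

theorem Term.subst_subst (t : Term) (f g : ℕ → Term) :
    (t.subst f).subst g = t.subst (fun n => (f n).subst g) := by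
  induction t with
  | var n => rfl
  | const c => rfl
  | S t ih => simp [Term.subst, ih]
  | bin o t u iht ihu => simp [Term.subst, iht, ihu]

@[simp] theorem Term.subst_var (t : Term) : t.subst .var = t := by
  induction t with
  | var n => rfl
  | const c => rfl
  | S t ih => simp [Term.subst, ih]
  | bin o t u iht ihu => simp [Term.subst, iht, ihu]

theorem Term.shift_subst (t : Term) (f : ℕ → Term) :
    t.shift.subst f = t.subst (fun n => f (n + 1)) := by
  simp [Term.shift, Term.subst_subst, Term.subst]

@[simp] theorem Term.shift_subst_scons (t u : Term) (f : ℕ → Term) :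
    t.shift.subst (scons u f) = t.subst f := t.shift_subst _

theorem Term.subst_shift (t : Term) (f : ℕ → Term) : (t.subst f).shift = t.subst (shiftSub f) :=
  t.subst_subst _ _

theorem scons_subst (t : Term) (f g : ℕ → Term) :
    (fun n => (scons t f n).subst g) = scons (t.subst g) (fun n => (f n).subst g) := by
  funext n; cases n <;> rfl

theorem up_subst_up (f g : ℕ → Term) :
    (fun n => (up f n).subst (up g)) = up (fun n => (f n).subst g) := by
  rw [scons_subst]
  congr 1
  funext n
  simp [shiftSub, Term.subst_shift]

theorem up_var : up .var = .var := by
  funext n; cases n <;> rfl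

theorem Formula.subst_subst (φ : Formula) (f g : ℕ → Term) :
    (φ.subst f).subst g = φ.subst (fun n => (f n).subst g) := by
  induction φ generalizing f g with
  | bot => rfl
  | eq t u => simp [Formula.subst, Term.subst_subst]
  | and φ ψ ih₁ ih₂ => simp [Formula.subst, ih₁, ih₂]
  | or φ ψ ih₁ ih₂ => simp [Formula.subst, ih₁, ih₂]
  | imp φ ψ ih₁ ih₂ => simp [Formula.subst, ih₁, ih₂]
  | all φ ih => simp only [Formula.subst, ih, up_subst_up f g]
  | ex φ ih => simp only [Formula.subst, ih, up_subst_up f g]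

@[simp] theorem Formula.subst_var (φ : Formula) : φ.subst .var = φ := by
  induction φ with
  | bot => rfl
  | eq t u => simp [Formula.subst]
  | and φ ψ ih₁ ih₂ => simp [Formula.subst, ih₁, ih₂]
  | or φ ψ ih₁ ih₂ => simp [Formula.subst, ih₁, ih₂]
  | imp φ ψ ih₁ ih₂ => simp [Formula.subst, ih₁, ih₂]
  | all φ ih => simpa only [Formula.subst, up_var, Formula.all.injEq] using ih
  | ex φ ih => simpa only [Formula.subst, up_var, Formula.ex.injEq] using ih

theorem Formula.subst_up_inst (φ : Formula) (f : ℕ → Term) (t : Term) :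
    (φ.subst (up f)).inst t = φ.subst (scons t f) := by
  rw [Formula.inst, Formula.subst_subst, scons_subst]
  congr 1
  simp [shiftSub, Term.subst]

@[simp] theorem Formula.shift_inst (φ : Formula) (t : Term) : φ.shift.inst t = φ := by
  rw [Formula.inst, Formula.shift, Formula.subst_subst]
  exact φ.subst_var

theorem Formula.shift_subst_up (φ : Formula) (f : ℕ → Term) :
    φ.shift.subst (up f) = (φ.subst f).shift := by
  simp only [Formula.shift, Formula.subst_subst]
  rfl

theorem Formula.inst_subst (φ : Formula) (t : Term) (f : ℕ → Term) :
    (φ.inst t).subst f = (φ.subst (up f)).inst (t.subst f) := by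
  rw [Formula.subst_up_inst, Formula.inst, Formula.subst_subst, scons_subst]
  rfl

/-! ## Fresh variables -/

/-- Only finitely many variables occur. Freshness is expressed as indifference of substitution to
values from `N` on, so no free-variable function is needed. -/
theorem Term.exists_bound (t : Term) :
    ∃ N, ∀ f g : ℕ → Term, (∀ n < N, f n = g n) → t.subst f = t.subst g := by
  induction t with
  | var n => exact ⟨n + 1, fun f g h => h n n.lt_succ_self⟩
  | const c => exact ⟨0, fun _ _ _ => rfl⟩
  | S t ih =>
    obtain ⟨N, hN⟩ := ih
    exact ⟨N, fun f g h => by simp [Term.subst, hN f g h]⟩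
  | bin o t u iht ihu =>
    obtain ⟨N, hN⟩ := iht
    obtain ⟨M, hM⟩ := ihu
    refine ⟨max N M, fun f g h => ?_⟩
    simp [Term.subst, hN f g fun n hn => h n (lt_max_of_lt_left hn),
      hM f g fun n hn => h n (lt_max_of_lt_right hn)]

theorem up_congr {N : ℕ} {f g : ℕ → Term} (h : ∀ n < N, f n = g n) :
    ∀ n < N, up f n = up g n
  | 0, _ => rfl
  | n + 1, hn => by simp [shiftSub, h n (by omega)]

theorem Formula.exists_bound (φ : Formula) :
    ∃ N, ∀ f g : ℕ → Term, (∀ n < N, f n = g n) → φ.subst f = φ.subst g := by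
  induction φ with
  | bot => exact ⟨0, fun _ _ _ => rfl⟩
  | eq t u =>
    obtain ⟨N, hN⟩ := t.exists_bound
    obtain ⟨M, hM⟩ := u.exists_bound
    refine ⟨max N M, fun f g h => ?_⟩
    simp [Formula.subst, hN f g fun n hn => h n (lt_max_of_lt_left hn),
      hM f g fun n hn => h n (lt_max_of_lt_right hn)]
  | and φ ψ iht ihu | or φ ψ iht ihu | imp φ ψ iht ihu =>
    obtain ⟨N, hN⟩ := iht
    obtain ⟨M, hM⟩ := ihu
    refine ⟨max N M, fun f g h => ?_⟩
    simp [Formula.subst, hN f g fun n hn => h n (lt_max_of_lt_left hn),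
      hM f g fun n hn => h n (lt_max_of_lt_right hn)]
  | all φ ih | ex φ ih =>
    obtain ⟨N, hN⟩ := ih
    exact ⟨N, fun f g h => by simp [Formula.subst, hN _ _ (up_congr h)]⟩

/-! ## Renaming in derivations -/

theorem up_renaming (ρ : ℕ → ℕ) :
    ∃ ρ' : ℕ → ℕ, up (fun n => .var (ρ n)) = fun n => .var (ρ' n) :=
  ⟨fun n => n.casesOn 0 fun n => ρ n + 1, by funext n; cases n <;> rfl⟩

/-- Only renamings are allowed: the axioms are stated for variables, which denote, and may fail for
arbitrary terms. Renamings extend under binders to renamings, which is what the quantifier rules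
require. -/
theorem Prov.rename {φ : Formula} (h : Prov φ) (ρ : ℕ → ℕ) :
    Prov (φ.subst fun n => .var (ρ n)) := by
  induction h generalizing ρ with
  | refl => exact .refl _
  | mp _ _ ih₁ ih₂ => exact .mp (ih₁ ρ) (ih₂ ρ)
  | trans _ _ ih₁ ih₂ => exact .trans (ih₁ ρ) (ih₂ ρ)
  | and_left => exact .and_left _ _
  | and_right => exact .and_right _ _
  | and_intro _ _ ih₁ ih₂ => exact .and_intro (ih₁ ρ) (ih₂ ρ)
  | or_left => exact .or_left _ _
  | or_right => exact .or_right _ _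
  | or_elim _ _ ih₁ ih₂ => exact .or_elim (ih₁ ρ) (ih₂ ρ)
  | curry _ ih => exact .curry (ih ρ)
  | uncurry _ ih => exact .uncurry (ih ρ)
  | bot_elim => exact .bot_elim _
  | all_intro _ ih =>
    obtain ⟨ρ', hρ'⟩ := up_renaming ρ
    refine .all_intro ?_
    rw [← Formula.shift_subst_up]
    have := ih ρ'
    rw [← hρ'] at this
    exact this
  | all_elim φ t =>
    have := Prov.all_elim (φ.subst (up fun n => .var (ρ n))) (t.subst fun n => .var (ρ n))
    rwa [← Formula.inst_subst] at this
  | ex_intro φ t =>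
    have := Prov.ex_intro (φ.subst (up fun n => .var (ρ n))) (t.subst fun n => .var (ρ n))
    rwa [← Formula.inst_subst] at this
  | ex_elim _ ih =>
    obtain ⟨ρ', hρ'⟩ := up_renaming ρ
    refine .ex_elim ?_
    rw [← Formula.shift_subst_up]
    have := ih ρ'
    rw [← hρ'] at this
    exact this
  | eq_refl => exact .eq_refl
  | eq_symm => exact .eq_symm
  | eq_trans => exact .eq_trans
  | eq_S => exact .eq_S
  | eq_bin o => exact .eq_bin o
  | strict_const c => exact .strict_const c
  | strict_S => exact .strict_S _
  | strict_bin_left => exact .strict_bin_left _ _ _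
  | strict_bin_right => exact .strict_bin_right _ _ _
  | strict_eq => exact .strict_eq _ _
  | S_dn => exact .S_dn _
  | add_dn => exact .add_dn _ _
  | mul_dn => exact .mul_dn _ _
  | S_inj => exact .S_inj _ _
  | zero_ne_S => exact .zero_ne_S _
  | add_zero => exact .add_zero _
  | add_S => exact .add_S _ _
  | mul_zero => exact .mul_zero _
  | mul_S => exact .mul_S _ _
  | k_eq => exact .k_eq _ _
  | s_dn => exact .s_dn _ _
  | s_eq => exact .s_eq _ _ _
  | p0_dn => exact .p0_dn _
  | p1_dn => exact .p1_dn _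
  | p0_eq => exact .p0_eq _ _
  | p1_eq => exact .p1_eq _ _
  | p_eq => exact .p_eq _
  | succ_eq => exact .succ_eq _
  | r_zero => exact .r_zero _ _
  | r_S => exact .r_S _ _ _
  | ind φ =>
    have := Prov.ind (φ.subst (up fun n => .var (ρ n)))
    have h₀ : (φ.subst (up fun n => .var (ρ n))).inst .zero =
        (φ.inst .zero).subst fun n => .var (ρ n) := (φ.inst_subst .zero _).symm
    have h₁ : (φ.subst (up fun n => .var (ρ n))).subst
          (scons (.S (.var 0)) fun n => .var (n + 1)) =
        (φ.subst (scons (.S (.var 0)) fun n => .var (n + 1))).subst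
          (up fun n => .var (ρ n)) := by
      simp only [Formula.subst_subst, scons_subst]
      rfl
    rw [h₀, h₁] at this
    exact this

/-! ## Entailment as forcing -/

/-- `φ` is derivable in `HAP` from `H`. Formulas `H` play the role of the worlds of a Kripke
model: entailment obeys the forcing clauses for conjunction, implication and universal
quantification. -/
def Ent (H φ : Formula) : Prop := Prov (.imp H φ)

infix:45 " ⊩ " => Ent

/-- The term `t` denotes at the world `H`. -/
abbrev Dn (H : Formula) (t : Term) : Prop := H ⊩ .dn t

variable {H K φ ψ : Formula} {t u v t' u' : Term}

theorem Ent.rfl : H ⊩ H := Prov.refl H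

theorem Ent.mono (h : H ⊩ φ) (hK : K ⊩ H) : K ⊩ φ := Prov.trans hK h

theorem Prov.ent (h : Prov φ) : H ⊩ φ := .mp h (.curry (.and_left _ _))

theorem Ent.mp (h : H ⊩ .imp φ ψ) (h' : H ⊩ φ) : H ⊩ ψ :=
  .trans (.and_intro h h') (.uncurry (.refl _))

theorem Prov.ent_mp (h : Prov (.imp φ ψ)) (h' : H ⊩ φ) : H ⊩ ψ := Prov.trans h' h

theorem Ent.bot (h : H ⊩ .bot) : H ⊩ φ := (Prov.bot_elim φ).ent_mp h

theorem ent_and_iff : H ⊩ .and φ ψ ↔ H ⊩ φ ∧ H ⊩ ψ :=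
  ⟨fun h => ⟨(Prov.and_left _ _).ent_mp h, (Prov.and_right _ _).ent_mp h⟩,
    fun h => Prov.and_intro h.1 h.2⟩

/-- Conversely, the single world `H ∧ φ` is enough. -/
theorem ent_imp_iff : H ⊩ .imp φ ψ ↔ ∀ K, K ⊩ H → K ⊩ φ → K ⊩ ψ :=
  ⟨fun h _ hK h' => (h.mono hK).mp h',
    fun h => Prov.curry (h _ (Prov.and_left _ _) (Prov.and_right _ _))⟩

theorem dn_var (i : ℕ) : Dn H (.var i) := Prov.ent (.mp (.S_dn i) (.strict_S _))

/-- From right to left, a variable fresh for `H` and `φ` serves as generic object. No change of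
world is needed, since every world already has unused variables. -/
theorem ent_all_iff : H ⊩ .all φ ↔ ∀ t, Dn H t → H ⊩ φ.inst t := by
  refine ⟨fun h t ht => (Prov.all_elim φ t).ent_mp (ent_and_iff.2 ⟨h, ht⟩), fun h => ?_⟩
  obtain ⟨N, hN⟩ := H.exists_bound
  obtain ⟨M, hM⟩ := φ.exists_bound
  -- The renaming sends the fresh variable to the index about to be bound and shifts all others,
  -- turning `H` into `H.shift` and the instance of `φ` back into `φ`.
  have hren := Prov.rename (h (.var (max N M)) (dn_var _))
    (fun n => if n = max N M then 0 else n + 1)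
  refine Prov.all_intro ?_
  have h₁ : H.shift = H.subst fun n => .var (if n = max N M then 0 else n + 1) :=
    hN _ _ fun n hn => by rw [if_neg (by omega)]
  have h₂ : φ = (φ.inst (.var (max N M))).subst
      fun n => .var (if n = max N M then 0 else n + 1) := by
    rw [Formula.inst, Formula.subst_subst]
    conv_lhs => rw [← φ.subst_var]
    refine hM _ _ fun n hn => ?_
    cases n with
    | zero => simp [Term.subst]
    | succ n => simp only [scons_succ, Term.subst]; rw [if_neg (by omega)]
  rw [h₁]
  conv => arg 1; arg 2; rw [h₂]
  exact hren

theorem Ent.all_inst {f : ℕ → Term} (h : H ⊩ (Formula.all φ).subst f) (ht : Dn H t) :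
    H ⊩ φ.subst (scons t f) := by
  rw [← Formula.subst_up_inst]
  exact ent_all_iff.1 h t ht

theorem ent_all_all_iff : H ⊩ .all (.all φ) ↔
    ∀ t u, Dn H t → Dn H u → H ⊩ φ.subst (scons u (scons t .var)) := by
  refine ⟨fun h t u ht hu => ?_, fun h => ent_all_iff.2 fun t ht => ?_⟩
  · rw [← Formula.subst_var (.all (.all φ))] at h
    exact (h.all_inst ht).all_inst hu
  · refine ent_all_iff.2 fun u hu => ?_
    have := h t u ht hu
    rwa [← Formula.subst_up_inst] at this

theorem Prov.gen (h : Prov φ) : Prov (.all φ) :=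
  -- The formula `⊥ → ⊥` plays the part of the empty set of hypotheses.
  .mp (.refl .bot) (.all_intro (h.ent : Formula.shift (.imp .bot .bot) ⊩ φ))

theorem Prov.inst₁ (h : Prov φ) (ht : Dn H t) : H ⊩ φ.subst (scons t .var) :=
  ent_all_iff.1 h.gen.ent t ht

theorem Prov.inst₂ (h : Prov φ) (ht : Dn H t) (hu : Dn H u) :
    H ⊩ φ.subst (scons u (scons t .var)) :=
  ent_all_all_iff.1 h.gen.gen.ent t u ht hu

theorem Prov.inst₃ (h : Prov φ) (ht : Dn H t) (hu : Dn H u) (hv : Dn H v) :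
    H ⊩ φ.subst (scons v (scons u (scons t .var))) :=
  Ent.all_inst (h.gen.inst₂ ht hu) hv

/-! ## Equality and strictness -/

theorem Ent.dn_left (h : H ⊩ .eq t u) : Dn H t :=
  (ent_and_iff.1 ((Prov.strict_eq t u).ent_mp h)).1

theorem Ent.dn_right (h : H ⊩ .eq t u) : Dn H u :=
  (ent_and_iff.1 ((Prov.strict_eq t u).ent_mp h)).2

theorem Ent.symm (h : H ⊩ .eq t u) : H ⊩ .eq u t :=
  (ent_all_all_iff.1 Prov.eq_symm.ent t u h.dn_left h.dn_right).mp h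

theorem Ent.trans (h : H ⊩ .eq t u) (h' : H ⊩ .eq u v) : H ⊩ .eq t v :=
  (Ent.all_inst (ent_all_all_iff.1 Prov.eq_trans.ent t u h.dn_left h.dn_right) h'.dn_right).mp
    (ent_and_iff.2 ⟨h, h'⟩)

theorem Ent.app_congr (h : H ⊩ .eq t t') (h' : H ⊩ .eq u u') (hd : Dn H (.app t u)) :
    H ⊩ .eq (.app t u) (.app t' u') :=
  (Ent.all_inst (Ent.all_inst (ent_all_all_iff.1 (Prov.eq_bin .app).ent t u h.dn_left h'.dn_left)
    h.dn_right) h'.dn_right).mp (ent_and_iff.2 ⟨ent_and_iff.2 ⟨h, h'⟩, hd⟩)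

theorem dn_const (c : Const) : Dn H (.const c) := (Prov.strict_const c).ent

theorem Ent.dn_fun (h : Dn H (.app t u)) : Dn H t := (Prov.strict_bin_left _ _ _).ent_mp h

theorem Ent.dn_arg (h : Dn H (.app t u)) : Dn H u := (Prov.strict_bin_right _ _ _).ent_mp h

theorem Ent.app_left (h : H ⊩ .eq t t') (hd : Dn H (.app t u)) :
    H ⊩ .eq (.app t u) (.app t' u) := h.app_congr hd.dn_arg hd

theorem Ent.app_right (h : H ⊩ .eq u u') (hd : Dn H (.app t u)) :
    H ⊩ .eq (.app t u) (.app t u') := Ent.app_congr hd.dn_fun h hd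

/-! ## The axioms of `HAP` for existing terms -/

theorem dn_S (ht : Dn H t) : Dn H (.S t) := (Prov.S_dn 0).inst₁ ht

theorem ent_S_inj (h : H ⊩ .eq (.S t) (.S u)) : H ⊩ .eq t u :=
  ((Prov.S_inj 1 0).inst₂ ((Prov.strict_S _).ent_mp h.dn_left)
    ((Prov.strict_S _).ent_mp h.dn_right)).mp h

theorem ent_zero_ne_S (h : H ⊩ .eq .zero (.S t)) : H ⊩ .bot :=
  ((Prov.zero_ne_S 0).inst₁ ((Prov.strict_S _).ent_mp h.dn_right)).mp h

theorem ent_k (ht : Dn H t) (hu : Dn H u) : H ⊩ .eq (.app (.app (.const .k) t) u) t :=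
  (Prov.k_eq 1 0).inst₂ ht hu

theorem dn_s (ht : Dn H t) (hu : Dn H u) : Dn H (.app (.app (.const .s) t) u) :=
  (Prov.s_dn 1 0).inst₂ ht hu

/-- Existence of the right-hand side is enough: it activates the Kleene equality, and by strictness
it makes `v` denote. -/
theorem ent_s (ht : Dn H t) (hu : Dn H u) (h : Dn H (.app (.app t v) (.app u v))) :
    H ⊩ .eq (.app (.app (.app (.const .s) t) u) v) (.app (.app t v) (.app u v)) :=
  ((Prov.s_eq 2 1 0).inst₃ ht hu h.dn_fun.dn_arg).mp ((Prov.or_right _ _).ent_mp h)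

theorem dn_fst (ht : Dn H t) : Dn H t.fst := (Prov.p0_dn 0).inst₁ ht

theorem dn_snd (ht : Dn H t) : Dn H t.snd := (Prov.p1_dn 0).inst₁ ht

/-- The pair `𝐩 · t · u`. -/
abbrev Term.pair (t u : Term) : Term := .app (.app (.const .p) t) u

theorem ent_fst (ht : Dn H t) (hu : Dn H u) : H ⊩ .eq (Term.pair t u).fst t :=
  (Prov.p0_eq 1 0).inst₂ ht hu

theorem ent_snd (ht : Dn H t) (hu : Dn H u) : H ⊩ .eq (Term.pair t u).snd u :=
  (Prov.p1_eq 1 0).inst₂ ht hu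

theorem dn_pair (ht : Dn H t) (hu : Dn H u) : Dn H (.pair t u) := (ent_fst ht hu).dn_left.dn_arg

theorem ent_pair (ht : Dn H t) : H ⊩ .eq (.pair t.fst t.snd) t := (Prov.p_eq 0).inst₁ ht

theorem ent_succ (ht : Dn H t) : H ⊩ .eq (.app (.const .succ) t) (.S t) :=
  (Prov.succ_eq 0).inst₁ ht

/-- The term `𝐫 · t · u · v`. -/
abbrev Term.recur (t u v : Term) : Term := .app (.app (.app (.const .r) t) u) v

theorem ent_recur_zero (ht : Dn H t) (hu : Dn H u) : H ⊩ .eq (.recur t u .zero) t :=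
  (Prov.r_zero 1 0).inst₂ ht hu

theorem ent_recur_S (h : Dn H (.app (.app u v) (.recur t u v))) :
    H ⊩ .eq (.recur t u (.S v)) (.app (.app u v) (.recur t u v)) :=
  ((Prov.r_S 2 1 0).inst₃ h.dn_arg.dn_fun.dn_fun.dn_arg h.dn_fun.dn_fun h.dn_fun.dn_arg).mp
    ((Prov.or_right _ _).ent_mp h)

theorem ent_ind (h₀ : H ⊩ φ.inst .zero)
    (hS : ∀ K t, K ⊩ H → Dn K t → K ⊩ φ.inst t → K ⊩ φ.inst (.S t)) (ht : Dn H t) :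
    H ⊩ φ.inst t := by
  refine ent_all_iff.1 ((Prov.ind φ).ent_mp (ent_and_iff.2 ⟨h₀, ?_⟩)) t ht
  refine ent_all_iff.2 fun u hu => ent_imp_iff.2 fun K hK h => ?_
  have := hS K u hK (hu.mono hK) h
  rw [Formula.subst_subst, scons_subst]
  exact this

/-- Case distinction on a number. -/
theorem ent_nat_cases (ht : Dn H t) (h₀ : ∀ K, K ⊩ H → K ⊩ .eq t .zero → K ⊩ φ)
    (hS : ∀ K u, K ⊩ H → K ⊩ .eq t (.S u) → K ⊩ φ) : H ⊩ φ := by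
  -- Induction on `n` for the formula `t = n → φ`, with the induction hypothesis ignored;
  -- instantiating `n` by `t` discharges the premise.
  have key : H ⊩ (Formula.imp (.eq t.shift (.var 0)) φ.shift).inst t := by
    have inst (u : Term) : (Formula.imp (.eq t.shift (.var 0)) φ.shift).inst u =
        .imp (.eq t u) φ := by
      have := φ.shift_inst u
      simp_all [Formula.inst, Formula.subst, Term.subst]
    refine ent_ind ?_ (fun K u hK _ _ => ?_) ht
    · rw [inst]
      exact ent_imp_iff.2 h₀
    · rw [inst]
      exact ent_imp_iff.2 fun K' hK' => hS K' u (hK.mono hK')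
  have h := φ.shift_inst t
  simp only [Formula.inst, Formula.subst, Term.subst, Term.shift_subst_scons, Term.subst_var,
    scons_zero] at h key
  rw [h] at key
  exact key.mp ht

/-! ## Combinatory completeness -/

/-- Closed terms that provably denote. -/
structure ClosedTerm : Type where
  term : Term
  subst_term : ∀ f, term.subst f = term
  prov_dn : Prov (.dn term)

def ClosedTerm.const (c : Const) : ClosedTerm := ⟨.const c, fun _ => rfl, .strict_const c⟩

/-- Applicative combinations of de Bruijn variables and closed terms. -/
inductive Poly : Type
  | var (n : ℕ)
  | cl (c : ClosedTerm)
  | app (p q : Poly)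

namespace Poly

abbrev const (c : Const) : Poly := cl (.const c)

abbrev fst (p : Poly) : Poly := app (const .p0) p

abbrev snd (p : Poly) : Poly := app (const .p1) p

abbrev pair (p q : Poly) : Poly := app (app (const .p) p) q

/-- The value of a polynomial when terms are substituted for the variables. -/
def eval (g : ℕ → Term) : Poly → Term
  | var n => g n
  | cl c => c.term
  | app p q => .app (p.eval g) (q.eval g)

/-- Abstraction of the variable with index `0`. -/
def lam : Poly → Poly
  | var 0 => app (app (const .s) (const .k)) (const .k)
  | var (n + 1) => app (const .k) (var n)
  | cl c => app (const .k) (cl c)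
  | app p q => app (app (const .s) p.lam) q.lam

variable {H : Formula} {g : ℕ → Term} {a : Term}

theorem eval_subst (p : Poly) (g f : ℕ → Term) :
    (p.eval g).subst f = p.eval fun n => (g n).subst f := by
  induction p with
  | var n => rfl
  | cl c => exact c.subst_term f
  | app p q ihp ihq => simp [eval, Term.subst, ihp, ihq]

/-- An abstraction denotes even where its body does not, because applications are suspended under
`𝐬`, and `𝐬 x y` always exists. -/
theorem dn_lam (p : Poly) (hg : ∀ n, Dn H (g n)) : Dn H (p.lam.eval g) := by
  induction p with
  | var n =>
    cases n with
    | zero => exact dn_s (dn_const _) (dn_const _)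
    | succ n => exact (ent_k (hg n) (hg n)).dn_left.dn_fun
  | cl c => exact (ent_k c.prov_dn.ent c.prov_dn.ent).dn_left.dn_fun
  | app p q ihp ihq => exact dn_s ihp ihq

/-- Strictness passes existence of the body down to its subpolynomials, where the induction
hypotheses apply. -/
theorem beta (p : Poly) (hg : ∀ n, Dn H (g n)) (ha : Dn H a) (h : Dn H (p.eval (scons a g))) :
    H ⊩ .eq (.app (p.lam.eval g) a) (p.eval (scons a g)) := by
  induction p with
  | var n =>
    cases n with
    | zero =>
      have h₁ : H ⊩ .eq (.app (.const .k) a) (.app (.const .k) a) := (ent_k ha ha).dn_left.dn_fun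
      have h₂ := ent_k ha h₁
      exact (ent_s (dn_const _) (dn_const _) h₂.dn_left).trans h₂
    | succ n => exact ent_k (hg n) ha
  | cl c => exact ent_k c.prov_dn.ent ha
  | app p q ihp ihq =>
    have hp := ihp (Ent.dn_fun h)
    have hq := ihq (Ent.dn_arg h)
    have hpq := hp.symm.app_congr hq.symm h
    exact (ent_s (p.dn_lam hg) (q.dn_lam hg) hpq.dn_right).trans hpq.symm

/-- The closed term denoting the function defined by a polynomial in one variable. -/
def toClosed (p : Poly) : ClosedTerm where
  -- Any variable beyond the abstracted one gets the default value `0`, so that the term is closed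
  -- whatever `p` is.
  term := p.lam.eval fun _ => .zero
  subst_term f := p.lam.eval_subst _ f
  prov_dn := .mp (.refl .bot) (p.dn_lam fun _ => dn_const _)

end Poly

end HAP

namespace HEO

open HAP
open HAP.Formula (dn)
open HAomega (Ty Ctx Var Sub)

/-! ## The relations `∼_σ` as partial equivalence relations -/

theorem shift_subst_up (t : Term) (f : ℕ → Term) :
    t.shift.subst (up f) = (t.subst f).shift := by
  rw [t.shift_subst_scons, t.subst_shift]

theorem sim_subst (σ : Ty) (t u : Term) (f : ℕ → Term) :
    (sim σ t u).subst f = sim σ (t.subst f) (u.subst f) := by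
  induction σ generalizing t u f with
  | nat => rfl
  | prod σ τ ihσ ihτ => simp [sim, Formula.subst, ihσ, ihτ, Term.subst]
  | arrow σ τ ihσ ihτ =>
    simp only [sim, Formula.subst, ihσ, ihτ, Term.subst, shift_subst_up]
    rfl

/-- `x ∼_σ y` holds at the world `H`, for denoting terms `x` and `y`. -/
def TyRel (σ : Ty) (H : Formula) (x y : Term) : Prop :=
  Dn H x ∧ Dn H y ∧ H ⊩ sim σ x y

namespace TyRel

variable {σ τ : Ty} {H K : Formula} {x y z x' y' : Term}

theorem mono (h : TyRel σ H x y) (hK : K ⊩ H) : TyRel σ K x y :=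
  ⟨h.1.mono hK, h.2.1.mono hK, h.2.2.mono hK⟩

theorem nat_iff : TyRel .nat H x y ↔ H ⊩ .eq x y :=
  ⟨fun h => h.2.2, fun h => ⟨h.dn_left, h.dn_right, h⟩⟩

theorem prod_iff : TyRel (.prod σ τ) H x y ↔ TyRel σ H x.fst y.fst ∧ TyRel τ H x.snd y.snd := by
  constructor
  · rintro ⟨hx, hy, h⟩
    obtain ⟨h₁, h₂⟩ := ent_and_iff.1 h
    exact ⟨⟨dn_fst hx, dn_fst hy, h₁⟩, dn_snd hx, dn_snd hy, h₂⟩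
  · rintro ⟨⟨hx, hy, h₁⟩, -, -, h₂⟩
    exact ⟨hx.dn_arg, hy.dn_arg, ent_and_iff.2 ⟨h₁, h₂⟩⟩

theorem arrow_iff_aux : TyRel (.arrow σ τ) H x y ↔ Dn H x ∧ Dn H y ∧ ∀ K, K ⊩ H → ∀ z z',
    TyRel σ K z z' → TyRel τ K (.app x z) (.app x z') ∧ TyRel τ K (.app y z) (.app y z') ∧
      TyRel τ K (.app x z) (.app y z) := by
  -- Unfolding literally asks for arguments that already denote at `L`. Arguments denoting only at a
  -- later world are reached by weakening to that world before unfolding.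
  have key (L : Formula) : L ⊩ sim (.arrow σ τ) x y ↔ ∀ z z', Dn L z → Dn L z' →
      ∀ K, K ⊩ L → K ⊩ sim σ z z' → TyRel τ K (.app x z) (.app x z') ∧
        TyRel τ K (.app y z) (.app y z') ∧ TyRel τ K (.app x z) (.app y z) := by
    simp only [sim, ent_all_all_iff, Formula.subst, sim_subst, Term.subst,
      Term.shift_subst_scons, Term.subst_var, scons_zero, scons_one, ent_imp_iff,
      ent_and_iff, TyRel]
    refine forall₂_congr fun z z' => forall₂_congr fun _ _ => forall₂_congr fun K _ =>
      imp_congr_right fun _ => ?_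
    exact ⟨fun ⟨a, b, c, d, e, f, g⟩ => ⟨⟨a, b, e⟩, ⟨c, d, f⟩, a, c, g⟩,
      fun ⟨⟨a, b, e⟩, ⟨c, d, f⟩, _, _, g⟩ => ⟨a, b, c, d, e, f, g⟩⟩
  constructor
  · rintro ⟨hx, hy, h⟩
    exact ⟨hx, hy, fun K hK z z' hz => (key K).1 (h.mono hK) z z' hz.1 hz.2.1 K .rfl hz.2.2⟩
  · rintro ⟨hx, hy, h⟩
    exact ⟨hx, hy, (key H).2 fun z z' hz hz' K hK hs => h K hK z z' ⟨hz.mono hK, hz'.mono hK, hs⟩⟩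

/-- `∼_σ` is a partial equivalence relation compatible with equality. -/
theorem isPER (σ : Ty) :
    (∀ {H x y}, TyRel σ H x y → TyRel σ H y x) ∧
    (∀ {H x y z}, TyRel σ H x y → TyRel σ H y z → TyRel σ H x z) ∧
    (∀ {H x x' y}, H ⊩ .eq x x' → TyRel σ H x y → TyRel σ H x' y) := by
  induction σ with
  | nat =>
    simp only [nat_iff]
    exact ⟨Ent.symm, Ent.trans, fun h h' => h.symm.trans h'⟩
  | prod σ τ ihσ ihτ =>
    obtain ⟨symmσ, transσ, respσ⟩ := ihσ
    obtain ⟨symmτ, transτ, respτ⟩ := ihτ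
    simp only [prod_iff]
    exact ⟨fun h => ⟨symmσ h.1, symmτ h.2⟩,
      fun h h' => ⟨transσ h.1 h'.1, transτ h.2 h'.2⟩,
      fun e h => ⟨respσ (e.app_right h.1.1) h.1, respτ (e.app_right h.2.1) h.2⟩⟩
  | arrow σ τ ihσ ihτ =>
    obtain ⟨symmσ, transσ, respσ⟩ := ihσ
    obtain ⟨symmτ, transτ, respτ⟩ := ihτ
    simp only [arrow_iff_aux]
    refine ⟨?_, ?_, ?_⟩
    · rintro H x y ⟨hx, hy, h⟩
      refine ⟨hy, hx, fun K hK z z' hz => ?_⟩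
      obtain ⟨h₁, h₂, h₃⟩ := h K hK z z' hz
      exact ⟨h₂, h₁, symmτ h₃⟩
    · rintro H x y w ⟨hx, hy, h⟩ ⟨-, hw, h'⟩
      refine ⟨hx, hw, fun K hK z z' hz => ?_⟩
      obtain ⟨h₁, h₂, h₃⟩ := h K hK z z' hz
      obtain ⟨-, h₅, h₆⟩ := h' K hK z z' hz
      exact ⟨h₁, h₅, transτ h₃ h₆⟩
    · rintro H x x' y e ⟨hx, hy, h⟩
      refine ⟨e.dn_right, hy, fun K hK z z' hz => ?_⟩
      obtain ⟨h₁, h₂, h₃⟩ := h K hK z z' hz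
      have e₁ := (e.mono hK).app_left h₁.1
      have e₂ := (e.mono hK).app_left h₁.2.1
      exact ⟨symmτ (respτ e₂ (symmτ (respτ e₁ h₁))), h₂, respτ e₁ h₃⟩

theorem symm (h : TyRel σ H x y) : TyRel σ H y x := (isPER σ).1 h

theorem trans (h : TyRel σ H x y) (h' : TyRel σ H y z) : TyRel σ H x z := (isPER σ).2.1 h h'

theorem left (h : TyRel σ H x y) : TyRel σ H x x := h.trans h.symm

theorem right (h : TyRel σ H x y) : TyRel σ H y y := h.symm.trans h

theorem resp_left (h : TyRel σ H x y) (e : H ⊩ .eq x x') : TyRel σ H x' y :=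
  (isPER σ).2.2 e h

theorem resp_right (h : TyRel σ H x y) (e : H ⊩ .eq y y') : TyRel σ H x y' :=
  (h.symm.resp_left e).symm

theorem resp (h : TyRel σ H x y) (e : H ⊩ .eq x x') (e' : H ⊩ .eq y y') : TyRel σ H x' y' :=
  (h.resp_left e).resp_right e'

/-- The clauses saying that `x` and `y` separately respect `∼` are redundant: they follow from the
mixed clause by symmetry and transitivity, using that `z` and `z'` are each related to themselves.
-/
theorem arrow_iff : TyRel (.arrow σ τ) H x y ↔ Dn H x ∧ Dn H y ∧ ∀ K, K ⊩ H → ∀ z z',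
    TyRel σ K z z' → TyRel τ K (.app x z) (.app y z') := by
  rw [arrow_iff_aux]
  refine and_congr_right fun _ => and_congr_right fun _ =>
    ⟨fun h K hK z z' hz => (h K hK z z' hz).2.2.trans (h K hK z z' hz).2.1,
      fun h K hK z z' hz => ?_⟩
  have h₁ := h K hK z z' hz
  have h₂ := h K hK z z hz.left
  have h₃ := h K hK z' z' hz.right
  exact ⟨h₁.trans h₃.symm, h₂.symm.trans h₁, h₂⟩

theorem app {f g : Term} (h : TyRel (.arrow σ τ) H f g) (hx : TyRel σ H x y) :
    TyRel τ H (.app f x) (.app g y) := (arrow_iff.1 h).2.2 H .rfl x y hx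

end TyRel

/-! ## The combinators preserve `∼` -/

section combinators

variable {ρ σ τ : Ty} {H : Formula}

theorem tyRel_k : TyRel (.arrow σ (.arrow τ σ)) H (.const .k) (.const .k) := by
  refine TyRel.arrow_iff.2 ⟨dn_const _, dn_const _, fun K hK x x' hx => ?_⟩
  refine TyRel.arrow_iff.2 ⟨(ent_k hx.1 hx.1).dn_left.dn_fun, (ent_k hx.2.1 hx.1).dn_left.dn_fun,
    fun K' hK' y y' hy => ?_⟩
  replace hx := hx.mono hK'
  exact hx.resp (ent_k hx.1 hy.1).symm (ent_k hx.2.1 hy.2.1).symm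

theorem tyRel_s : TyRel (.arrow (.arrow ρ (.arrow σ τ)) (.arrow (.arrow ρ σ) (.arrow ρ τ))) H
    (.const .s) (.const .s) := by
  refine TyRel.arrow_iff.2 ⟨dn_const _, dn_const _, fun K hK x x' hx => ?_⟩
  refine TyRel.arrow_iff.2 ⟨(dn_s hx.1 hx.1).dn_fun, (dn_s hx.2.1 hx.1).dn_fun,
    fun K' hK' y y' hy => ?_⟩
  replace hx := hx.mono hK'
  refine TyRel.arrow_iff.2 ⟨dn_s hx.1 hy.1, dn_s hx.2.1 hy.2.1, fun L hL z z' hz => ?_⟩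
  replace hx := hx.mono hL
  replace hy := hy.mono hL
  have h := (hx.app hz).app (hy.app hz)
  exact h.resp (ent_s hx.1 hy.1 h.1).symm (ent_s hx.2.1 hy.2.1 h.2.1).symm

theorem TyRel.pair {x x' y y' : Term} (hx : TyRel σ H x x') (hy : TyRel τ H y y') :
    TyRel (.prod σ τ) H (.pair x y) (.pair x' y') :=
  TyRel.prod_iff.2 ⟨hx.resp (ent_fst hx.1 hy.1).symm (ent_fst hx.2.1 hy.2.1).symm,
    hy.resp (ent_snd hx.1 hy.1).symm (ent_snd hx.2.1 hy.2.1).symm⟩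

theorem tyRel_p : TyRel (.arrow σ (.arrow τ (.prod σ τ))) H (.const .p) (.const .p) := by
  refine TyRel.arrow_iff.2 ⟨dn_const _, dn_const _, fun K hK x x' hx => ?_⟩
  refine TyRel.arrow_iff.2 ⟨(dn_pair hx.1 hx.1).dn_fun, (dn_pair hx.2.1 hx.1).dn_fun,
    fun K' hK' y y' hy => (hx.mono hK').pair hy⟩

theorem tyRel_p0 : TyRel (.arrow (.prod σ τ) σ) H (.const .p0) (.const .p0) :=
  TyRel.arrow_iff.2 ⟨dn_const _, dn_const _, fun _ _ _ _ h => (TyRel.prod_iff.1 h).1⟩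

theorem tyRel_p1 : TyRel (.arrow (.prod σ τ) τ) H (.const .p1) (.const .p1) :=
  TyRel.arrow_iff.2 ⟨dn_const _, dn_const _, fun _ _ _ _ h => (TyRel.prod_iff.1 h).2⟩

theorem tyRel_zero : TyRel .nat H .zero .zero := TyRel.nat_iff.2 (dn_const _)

theorem tyRel_succ : TyRel (.arrow .nat .nat) H (.const .succ) (.const .succ) :=
  TyRel.arrow_iff.2 ⟨dn_const _, dn_const _, fun _ _ _ _ h => TyRel.nat_iff.2
    ((TyRel.nat_iff.1 h).app_right (ent_succ h.1).dn_left)⟩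

/-- The formula `x ↓ ∧ y ↓ ∧ x ∼_σ y`. -/
def tyRelFormula (σ : Ty) (x y : Term) : Formula := .and (dn x) (.and (dn y) (sim σ x y))

theorem ent_tyRelFormula {x y : Term} : H ⊩ tyRelFormula σ x y ↔ TyRel σ H x y := by
  simp only [tyRelFormula, ent_and_iff, TyRel]

/-- Induction inside `HAP` on `n`. One number suffices on both sides because `∼` at type `0` is
equality. -/
theorem TyRel.recur {x x' y y' n : Term} (hx : TyRel σ H x x')
    (hy : TyRel (.arrow .nat (.arrow σ σ)) H y y') (hn : Dn H n) :
    TyRel σ H (.recur x y n) (.recur x' y' n) := by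
  have inst (t : Term) : (tyRelFormula σ (.recur x.shift y.shift (.var 0))
      (.recur x'.shift y'.shift (.var 0))).inst t =
        tyRelFormula σ (.recur x y t) (.recur x' y' t) := by
    simp [tyRelFormula, Formula.inst, Formula.subst, sim_subst, Term.subst]
  rw [← ent_tyRelFormula, ← inst]
  refine ent_ind ?_ (fun K t hK ht h => ?_) hn
  · rw [inst, ent_tyRelFormula]
    exact hx.resp (ent_recur_zero hx.1 hy.1).symm (ent_recur_zero hx.2.1 hy.2.1).symm
  · rw [inst, ent_tyRelFormula] at h ⊢
    have h' := ((hy.mono hK).app (TyRel.nat_iff.2 ht)).app h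
    exact h'.resp (ent_recur_S h'.1).symm (ent_recur_S h'.2.1).symm

theorem tyRel_r : TyRel (.arrow σ (.arrow (.arrow .nat (.arrow σ σ)) (.arrow .nat σ))) H
    (.const .r) (.const .r) := by
  -- No axiom says that `𝐫 x` denotes. Since `𝐫 x 𝐤 0 = x` exists for the dummy argument `𝐤`,
  -- strictness gives it.
  have k (K : Formula) : Dn K (.const .k) := dn_const _
  refine TyRel.arrow_iff.2 ⟨dn_const _, dn_const _, fun K hK x x' hx => ?_⟩
  refine TyRel.arrow_iff.2 ⟨(ent_recur_zero hx.1 (k K)).dn_left.dn_fun.dn_fun,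
    (ent_recur_zero hx.2.1 (k K)).dn_left.dn_fun.dn_fun, fun K' hK' y y' hy => ?_⟩
  replace hx := hx.mono hK'
  refine TyRel.arrow_iff.2 ⟨(ent_recur_zero hx.1 hy.1).dn_left.dn_fun,
    (ent_recur_zero hx.2.1 hy.2.1).dn_left.dn_fun, fun L hL n n' hn => ?_⟩
  have h := (hx.mono hL).recur (hy.mono hL) hn.1
  exact h.resp_right ((TyRel.nat_iff.1 hn).app_right h.2.1)

end combinators

/-! ## Environments -/

section environments

variable {Γ Δ : Ctx} {σ τ : Ty} {H K : Formula} {f f' f'' : ℕ → Term} {x y : Term}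

/-- Two assignments of terms to the variables of a context are related by `∼` at the world `H`. -/
def EnvRel (Γ : Ctx) (H : Formula) (f f' : ℕ → Term) : Prop :=
  ∀ σ, ∀ v : Var Γ σ, TyRel σ H (f v.toNat) (f' v.toNat)

namespace EnvRel

theorem mono (h : EnvRel Γ H f f') (hK : K ⊩ H) : EnvRel Γ K f f' := fun σ v => (h σ v).mono hK

theorem symm (h : EnvRel Γ H f f') : EnvRel Γ H f' f := fun σ v => (h σ v).symm

theorem trans (h : EnvRel Γ H f f') (h' : EnvRel Γ H f' f'') : EnvRel Γ H f f'' :=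
  fun σ v => (h σ v).trans (h' σ v)

theorem left (h : EnvRel Γ H f f') : EnvRel Γ H f f := h.trans h.symm

theorem right (h : EnvRel Γ H f f') : EnvRel Γ H f' f' := h.symm.trans h

theorem cons (h : EnvRel Γ H f f') (hx : TyRel σ H x y) :
    EnvRel (σ :: Γ) H (scons x f) (scons y f')
  | _, .here => hx
  | _, .there v => h _ v

theorem tail (h : EnvRel (σ :: Γ) H f f') :
    EnvRel Γ H (fun n => f (n + 1)) (fun n => f' (n + 1)) := fun _ v => h _ (.there v)

/-- The interpretations of typed terms respect `∼`. -/
theorem tm (h : EnvRel Γ H f f') (t : HAomega.Term Γ σ) : TyRel σ H (tm f t) (tm f' t) := by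
  induction t with
  | var v => exact h _ v
  | k => exact tyRel_k
  | s => exact tyRel_s
  | p => exact tyRel_p
  | p0 => exact tyRel_p0
  | p1 => exact tyRel_p1
  | zero => exact tyRel_zero
  | S => exact tyRel_succ
  | R => exact tyRel_r
  | app _ _ ih₁ ih₂ => exact ih₁.app ih₂

end EnvRel

theorem tm_subst_right (t : HAomega.Term Γ σ) (f g : ℕ → Term) :
    (tm f t).subst g = tm (fun n => (f n).subst g) t := by
  induction t with
  | app _ _ ih₁ ih₂ => simp [tm, Term.subst, ih₁, ih₂]
  | _ => rfl

/-- The assignment `f'` is the composition of the typed substitution `g` with `f`. -/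
def Comp (g : Sub Γ Δ) (f f' : ℕ → Term) : Prop :=
  ∀ σ, ∀ v : Var Γ σ, f' v.toNat = tm f (g σ v)

theorem Comp.tm_subst {g : Sub Γ Δ} (h : Comp g f f') (t : HAomega.Term Γ σ) :
    tm f (t.subst g) = tm f' t := by
  induction t with
  | var v => exact (h _ v).symm
  | app _ _ ih₁ ih₂ => simp [tm, HAomega.Term.subst, ih₁, ih₂]
  | _ => rfl

theorem Comp.shift {g : Sub Γ Δ} (h : Comp g f f') : Comp g (shiftSub f) (shiftSub f') :=
  fun σ v => by simp only [shiftSub, h σ v, Term.shift, tm_subst_right]; rfl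

theorem comp_wkSub (τ : Ty) (t : Term) (f : ℕ → Term) :
    Comp (HAomega.wkSub Γ τ) (scons t f) f := fun _ _ => rfl

theorem Comp.up {g : Sub Γ Δ} (h : Comp g f f') (t : Term) :
    Comp (HAomega.up τ g) (scons t f) (scons t f')
  | _, .here => rfl
  | _, .there v => (h _ v).trans ((comp_wkSub τ t f).tm_subst (g _ v)).symm

end environments

/-! ## Extensional realizability as a partial equivalence relation -/

theorem shiftSub_subst_up (f g : ℕ → Term) :
    (fun n => (shiftSub f n).subst (up g)) = shiftSub fun n => (f n).subst g :=
  funext fun _ => shift_subst_up _ _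

theorem shiftSub_subst_scons (f g : ℕ → Term) (t : Term) :
    (fun n => (shiftSub f n).subst (scons t g)) = fun n => (f n).subst g :=
  funext fun _ => Term.shift_subst_scons _ _ _

theorem shiftSub_subst_scons_var (f : ℕ → Term) (t : Term) :
    (fun n => (shiftSub f n).subst (scons t .var)) = f := by
  rw [shiftSub_subst_scons]
  exact funext fun _ => Term.subst_var _

theorem shiftSub_shiftSub_subst (f : ℕ → Term) (t u : Term) :
    (fun n => (shiftSub (shiftSub f) n).subst (scons u (scons t .var))) = f := by
  rw [shiftSub_subst_scons, shiftSub_subst_scons_var]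

namespace Interp

variable {Γ : Ctx} {σ : Ty} {H K : Formula} {f f' : ℕ → Term} {x y z x' y' : Term}
  {φ ψ I : Interp}

/-- `x = x' e φ` holds at the world `H`, for denoting terms `x` and `x'`. -/
def rel (I : Interp) (H : Formula) (f : ℕ → Term) (x y : Term) : Prop :=
  Dn H x ∧ Dn H y ∧ H ⊩ I.same f x y

theorem rel.mono (h : I.rel H f x y) (hK : K ⊩ H) : I.rel K f x y :=
  ⟨h.1.mono hK, h.2.1.mono hK, h.2.2.mono hK⟩

theorem rel_of_bot (h : H ⊩ .bot) : I.rel H f x y := ⟨h.bot, h.bot, h.bot⟩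

/-- The formulas of `I` commute with substitution, `x e I` means `x = x e I`, and `x = x' e I` is
a partial equivalence relation that respects equality and, in the variables in `Γ`, the relations
`∼`. -/
structure Good (Γ : Ctx) (I : Interp) : Prop where
  same_subst (f g : ℕ → Term) (x y : Term) :
    (I.same f x y).subst g = I.same (fun n => (f n).subst g) (x.subst g) (y.subst g)
  real_subst (f g : ℕ → Term) (x : Term) :
    (I.real f x).subst g = I.real (fun n => (f n).subst g) (x.subst g)
  real_iff {H : Formula} {f : ℕ → Term} {x : Term} :
    EnvRel Γ H f f → Dn H x → (H ⊩ I.real f x ↔ I.rel H f x x)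
  env {H : Formula} {f f' : ℕ → Term} {x y : Term} :
    EnvRel Γ H f f' → I.rel H f x y → I.rel H f' x y
  symm {H : Formula} {f : ℕ → Term} {x y : Term} : EnvRel Γ H f f → I.rel H f x y → I.rel H f y x
  trans {H : Formula} {f : ℕ → Term} {x y z : Term} :
    EnvRel Γ H f f → I.rel H f x y → I.rel H f y z → I.rel H f x z
  resp_left {H : Formula} {f : ℕ → Term} {x x' y : Term} :
    EnvRel Γ H f f → I.rel H f x y → H ⊩ .eq x x' → I.rel H f x' y

namespace Good

theorem left (h : I.Good Γ) (hf : EnvRel Γ H f f) (hx : I.rel H f x y) : I.rel H f x x :=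
  h.trans hf hx (h.symm hf hx)

theorem right (h : I.Good Γ) (hf : EnvRel Γ H f f) (hx : I.rel H f x y) : I.rel H f y y :=
  h.trans hf (h.symm hf hx) hx

theorem resp (h : I.Good Γ) (hf : EnvRel Γ H f f) (hx : I.rel H f x y) (e : H ⊩ .eq x x')
    (e' : H ⊩ .eq y y') : I.rel H f x' y' :=
  h.symm hf (h.resp_left hf (h.symm hf (h.resp_left hf hx e)) e')

end Good

/-! ### Atomic formulas -/

section atom

variable {A : (ℕ → Term) → Formula}

theorem rel_atom_iff : (atom A).rel H f x y ↔ H ⊩ A f ∧ H ⊩ .eq x y := by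
  simp only [rel, atom, ent_and_iff]
  exact ⟨fun h => h.2.2, fun h => ⟨h.2.dn_left, h.2.dn_right, h⟩⟩

/-- Realizers of an atom are compared by plain equality, so only invariance of its truth under `∼`
in the variables has content. -/
theorem good_atom (hA : ∀ f g, (A f).subst g = A fun n => (f n).subst g)
    (henv : ∀ {H f f'}, EnvRel Γ H f f' → H ⊩ A f → H ⊩ A f') : (atom A).Good Γ where
  same_subst f g x y := by simp only [atom, Formula.subst, hA]
  real_subst f g x := hA f g
  real_iff _ hx := by
    rw [rel_atom_iff]
    exact ⟨fun h => ⟨h, hx⟩, fun h => h.1⟩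
  env hf h := by
    rw [rel_atom_iff] at h ⊢
    exact ⟨henv hf h.1, h.2⟩
  symm _ h := by
    rw [rel_atom_iff] at h ⊢
    exact ⟨h.1, h.2.symm⟩
  trans _ h h' := by
    rw [rel_atom_iff] at h h' ⊢
    exact ⟨h.1, h.2.trans h'.2⟩
  resp_left _ h e := by
    rw [rel_atom_iff] at h ⊢
    exact ⟨h.1, e.symm.trans h.2⟩

end atom

/-! ### Conjunction -/

theorem rel_and_iff : (φ.and ψ).rel H f x y ↔ φ.rel H f x.fst y.fst ∧ ψ.rel H f x.snd y.snd := by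
  constructor
  · rintro ⟨hx, hy, h⟩
    obtain ⟨h₁, h₂⟩ := ent_and_iff.1 h
    exact ⟨⟨dn_fst hx, dn_fst hy, h₁⟩, dn_snd hx, dn_snd hy, h₂⟩
  · rintro ⟨⟨hx, hy, h₁⟩, -, -, h₂⟩
    exact ⟨hx.dn_arg, hy.dn_arg, ent_and_iff.2 ⟨h₁, h₂⟩⟩

theorem Good.and (hφ : φ.Good Γ) (hψ : ψ.Good Γ) : (φ.and ψ).Good Γ where
  same_subst f g x y := by
    simp only [Interp.and, Formula.subst, hφ.same_subst, hψ.same_subst]; rfl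
  real_subst f g x := by
    simp only [Interp.and, Formula.subst, hφ.real_subst, hψ.real_subst]; rfl
  real_iff hf hx := by
    rw [rel_and_iff, ← hφ.real_iff hf (dn_fst hx), ← hψ.real_iff hf (dn_snd hx)]
    exact ent_and_iff
  env hf h := by
    rw [rel_and_iff] at h ⊢
    exact ⟨hφ.env hf h.1, hψ.env hf h.2⟩
  symm hf h := by
    rw [rel_and_iff] at h ⊢
    exact ⟨hφ.symm hf h.1, hψ.symm hf h.2⟩
  trans hf h h' := by
    rw [rel_and_iff] at h h' ⊢
    exact ⟨hφ.trans hf h.1 h'.1, hψ.trans hf h.2 h'.2⟩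
  resp_left hf h e := by
    rw [rel_and_iff] at h ⊢
    exact ⟨hφ.resp_left hf h.1 (e.app_right h.1.1), hψ.resp_left hf h.2 (e.app_right h.2.1)⟩

/-! ### Implication -/

theorem ent_impReal_iff (hφ : φ.Good Γ) (hψ : ψ.Good Γ) : H ⊩ impReal φ ψ f x ↔
    ∀ K, K ⊩ H → ∀ y y', φ.rel K f y y' → ψ.rel K f (.app x y) (.app x y') := by
  have key (L : Formula) : L ⊩ impReal φ ψ f x ↔ ∀ y y', Dn L y → Dn L y' →
      ∀ K, K ⊩ L → K ⊩ φ.same f y y' → ψ.rel K f (.app x y) (.app x y') := by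
    simp only [impReal, ent_all_all_iff, Formula.subst, hφ.same_subst, hψ.same_subst, Term.subst,
      Term.shift_subst_scons, Term.subst_var, scons_zero, scons_one, ent_imp_iff,
      ent_and_iff, shiftSub_shiftSub_subst, rel]
  exact ⟨fun h K hK y y' hy => (key K).1 (h.mono hK) y y' hy.1 hy.2.1 K .rfl hy.2.2,
    fun h => (key H).2 fun y y' hy hy' K hK hs => h K hK y y' ⟨hy.mono hK, hy'.mono hK, hs⟩⟩

/-- The same collapse as in `TyRel.arrow_iff`: agreement on equal arguments plus extensionality of
both sides amounts to the mixed clause. -/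
theorem rel_imp_iff (hφ : φ.Good Γ) (hψ : ψ.Good Γ) (hf : EnvRel Γ H f f) :
    (φ.imp ψ).rel H f x x' ↔ Dn H x ∧ Dn H x' ∧ ∀ K, K ⊩ H → ∀ y y', φ.rel K f y y' →
      ψ.rel K f (.app x y) (.app x' y') := by
  refine and_congr_right fun hx => and_congr_right fun hx' => ?_
  simp only [imp, ent_and_iff, ent_impReal_iff hφ hψ]
  have key (L : Formula) : L ⊩ .all (.imp (φ.real (shiftSub f) (.var 0))
      (ψ.same (shiftSub f) (.app x.shift (.var 0)) (.app x'.shift (.var 0)))) ↔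
      ∀ y, Dn L y → ∀ K, K ⊩ L → K ⊩ φ.real f y → K ⊩ ψ.same f (.app x y) (.app x' y) := by
    simp only [ent_all_iff, Formula.inst, Formula.subst, hφ.real_subst, hψ.same_subst, Term.subst,
      Term.shift_subst_scons, Term.subst_var, scons_zero, ent_imp_iff, shiftSub_subst_scons_var]
  constructor
  · rintro ⟨h, h', h''⟩ K hK y y' hy
    have hfK := hf.mono hK
    have h₁ := h' K hK y y' hy
    have h₂ := (key K).1 (h''.mono hK) y hy.1 K .rfl
      ((hφ.real_iff hfK hy.1).2 (hφ.left hfK hy))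
    exact hψ.trans hfK ⟨(h K hK y y' hy).1, h₁.1, h₂⟩ h₁
  · intro h
    refine ⟨fun K hK y y' hy => ?_, fun K hK y y' hy => ?_, (key H).2 fun y hy K hK hr => ?_⟩
    · have hfK := hf.mono hK
      exact hψ.trans hfK (h K hK y y' hy) (hψ.symm hfK (h K hK y' y' (hφ.right hfK hy)))
    · have hfK := hf.mono hK
      exact hψ.trans hfK (hψ.symm hfK (h K hK y y (hφ.left hfK hy))) (h K hK y y' hy)
    · exact (h K hK y y ((hφ.real_iff (hf.mono hK) (hy.mono hK)).1 hr)).2.2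

theorem Good.imp (hφ : φ.Good Γ) (hψ : ψ.Good Γ) : (φ.imp ψ).Good Γ where
  same_subst f g x y := by
    simp only [Interp.imp, impReal, Formula.subst, hφ.same_subst, hψ.same_subst, hφ.real_subst,
      shiftSub_subst_up, shift_subst_up, Term.subst]
    rfl
  real_subst f g x := by
    simp only [Interp.imp, impReal, Formula.subst, hφ.same_subst, hψ.same_subst,
      shiftSub_subst_up, shift_subst_up, Term.subst]
    rfl
  real_iff {H f x} hf hx := by
    rw [rel_imp_iff hφ hψ hf]
    refine (ent_impReal_iff hφ hψ).trans ⟨fun h => ⟨hx, hx, h⟩, fun h => h.2.2⟩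
  env hf h := by
    rw [rel_imp_iff hφ hψ hf.left] at h
    rw [rel_imp_iff hφ hψ hf.right]
    refine ⟨h.1, h.2.1, fun K hK y y' hy => ?_⟩
    have hfK := hf.mono hK
    exact hψ.env hfK (h.2.2 K hK y y' (hφ.env hfK.symm hy))
  symm hf h := by
    rw [rel_imp_iff hφ hψ hf] at h ⊢
    refine ⟨h.2.1, h.1, fun K hK y y' hy => ?_⟩
    have hfK := hf.mono hK
    exact hψ.symm hfK (h.2.2 K hK y' y (hφ.symm hfK hy))
  trans hf h h' := by
    rw [rel_imp_iff hφ hψ hf] at h h' ⊢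
    refine ⟨h.1, h'.2.1, fun K hK y y' hy => ?_⟩
    have hfK := hf.mono hK
    exact hψ.trans hfK (h.2.2 K hK y y' hy) (h'.2.2 K hK y' y' (hφ.right hfK hy))
  resp_left hf h e := by
    rw [rel_imp_iff hφ hψ hf] at h ⊢
    refine ⟨e.dn_right, h.2.1, fun K hK y y' hy => ?_⟩
    have h' := h.2.2 K hK y y' hy
    exact hψ.resp_left (hf.mono hK) h' ((e.mono hK).app_left h'.1)

/-! ### Quantifiers -/

theorem ent_allReal_iff (hφ : φ.Good (σ :: Γ)) : H ⊩ allReal σ φ f x ↔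
    ∀ K, K ⊩ H → ∀ y y', TyRel σ K y y' → φ.rel K (scons y f) (.app x y) (.app x y') := by
  have key (L : Formula) : L ⊩ allReal σ φ f x ↔ ∀ y y', Dn L y → Dn L y' →
      ∀ K, K ⊩ L → K ⊩ sim σ y y' → φ.rel K (scons y f) (.app x y) (.app x y') := by
    simp only [allReal, ent_all_all_iff, Formula.subst, sim_subst, hφ.same_subst, Term.subst,
      Term.shift_subst_scons, Term.subst_var, scons_zero, scons_one, ent_imp_iff,
      ent_and_iff, shiftSub_shiftSub_subst, scons_subst, rel]
  exact ⟨fun h K hK y y' hy => (key K).1 (h.mono hK) y y' hy.1 hy.2.1 K .rfl hy.2.2,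
    fun h => (key H).2 fun y y' hy hy' K hK hs => h K hK y y' ⟨hy.mono hK, hy'.mono hK, hs⟩⟩

theorem rel_all_iff (hφ : φ.Good (σ :: Γ)) (hf : EnvRel Γ H f f) :
    (φ.all σ).rel H f x x' ↔ Dn H x ∧ Dn H x' ∧ ∀ K, K ⊩ H → ∀ y y', TyRel σ K y y' →
      φ.rel K (scons y f) (.app x y) (.app x' y') := by
  refine and_congr_right fun hx => and_congr_right fun hx' => ?_
  simp only [all, ent_and_iff, ent_allReal_iff hφ]
  have key (L : Formula) : L ⊩ .all (.imp (heo σ (.var 0))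
      (φ.same (scons (.var 0) (shiftSub f)) (.app x.shift (.var 0)) (.app x'.shift (.var 0)))) ↔
      ∀ y, Dn L y → ∀ K, K ⊩ L → K ⊩ heo σ y →
        K ⊩ φ.same (scons y f) (.app x y) (.app x' y) := by
    simp only [ent_all_iff, Formula.inst, Formula.subst, heo, sim_subst, hφ.same_subst, Term.subst,
      Term.shift_subst_scons, Term.subst_var, scons_zero, ent_imp_iff, scons_subst,
      shiftSub_subst_scons_var]
  constructor
  · rintro ⟨h, h', h''⟩ K hK y y' hy
    have h₁ := h' K hK y y' hy
    have h₂ := (key K).1 (h''.mono hK) y hy.1 K .rfl hy.left.2.2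
    exact hφ.trans ((hf.mono hK).cons hy.left) ⟨(h K hK y y' hy).1, h₁.1, h₂⟩ h₁
  · intro h
    refine ⟨fun K hK y y' hy => ?_, fun K hK y y' hy => ?_, (key H).2 fun y hy K hK hr => ?_⟩
    · have hfK := hf.mono hK
      have hfy := hfK.cons hy.left
      -- The instance at `y'` speaks of `φ` with `y'` for the variable; invariance in the
      -- environment moves it to `y` before transitivity is used.
      exact hφ.trans hfy (h K hK y y' hy)
        (hφ.symm hfy (hφ.env (hfK.cons hy.symm) (h K hK y' y' hy.right)))
    · have hfy := (hf.mono hK).cons hy.left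
      exact hφ.trans hfy (hφ.symm hfy (h K hK y y hy.left)) (h K hK y y' hy)
    · exact (h K hK y y ⟨hy.mono hK, hy.mono hK, hr⟩).2.2

theorem Good.all (hφ : φ.Good (σ :: Γ)) : (φ.all σ).Good Γ where
  same_subst f g x y := by
    simp only [Interp.all, allReal, Formula.subst, heo, sim_subst, hφ.same_subst,
      shiftSub_subst_up, shift_subst_up, scons_subst, Term.subst]
    rfl
  real_subst f g x := by
    simp only [Interp.all, allReal, Formula.subst, sim_subst, hφ.same_subst,
      shiftSub_subst_up, shift_subst_up, scons_subst, Term.subst]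
    rfl
  real_iff {H f x} hf hx := by
    rw [rel_all_iff hφ hf]
    refine (ent_allReal_iff hφ).trans ⟨fun h => ⟨hx, hx, h⟩, fun h => h.2.2⟩
  env hf h := by
    rw [rel_all_iff hφ hf.left] at h
    rw [rel_all_iff hφ hf.right]
    exact ⟨h.1, h.2.1, fun K hK y y' hy => hφ.env ((hf.mono hK).cons hy.left) (h.2.2 K hK y y' hy)⟩
  symm hf h := by
    rw [rel_all_iff hφ hf] at h ⊢
    refine ⟨h.2.1, h.1, fun K hK y y' hy => ?_⟩
    have hfK := hf.mono hK
    exact hφ.symm (hfK.cons hy.left) (hφ.env (hfK.cons hy.symm) (h.2.2 K hK y' y hy.symm))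
  trans hf h h' := by
    rw [rel_all_iff hφ hf] at h h' ⊢
    refine ⟨h.1, h'.2.1, fun K hK y y' hy => ?_⟩
    have hfy := (hf.mono hK).cons hy.left
    exact hφ.trans hfy (h.2.2 K hK y y hy.left) (h'.2.2 K hK y y' hy)
  resp_left hf h e := by
    rw [rel_all_iff hφ hf] at h ⊢
    refine ⟨e.dn_right, h.2.1, fun K hK y y' hy => ?_⟩
    have h' := h.2.2 K hK y y' hy
    exact hφ.resp_left ((hf.mono hK).cons hy.left) h' ((e.mono hK).app_left h'.1)

/-- The clause is lopsided: `φ` is evaluated at the left witness only. Symmetry and transitivity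
therefore rest on invariance in the environment. -/
theorem rel_ex_iff : (φ.ex σ).rel H f x y ↔
    TyRel σ H x.fst y.fst ∧ φ.rel H (scons x.fst f) x.snd y.snd := by
  constructor
  · rintro ⟨hx, hy, h⟩
    obtain ⟨h₁, h₂⟩ := ent_and_iff.1 h
    exact ⟨⟨dn_fst hx, dn_fst hy, h₂⟩, dn_snd hx, dn_snd hy, h₁⟩
  · rintro ⟨⟨hx, hy, h₁⟩, -, -, h₂⟩
    exact ⟨hx.dn_arg, hy.dn_arg, ent_and_iff.2 ⟨h₂, h₁⟩⟩

theorem Good.ex (hφ : φ.Good (σ :: Γ)) : (φ.ex σ).Good Γ where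
  same_subst f g x y := by
    simp only [Interp.ex, Formula.subst, sim_subst, hφ.same_subst, scons_subst]; rfl
  real_subst f g x := by
    simp only [Interp.ex, Formula.subst, heo, sim_subst, hφ.real_subst, scons_subst]; rfl
  real_iff {H f x} hf hx := by
    rw [rel_ex_iff]
    have h : H ⊩ heo σ x.fst ↔ TyRel σ H x.fst x.fst :=
      ⟨fun h => ⟨dn_fst hx, dn_fst hx, h⟩, fun h => h.2.2⟩
    exact ent_and_iff.trans ((and_congr_left' h).trans
      (and_congr_right fun h => hφ.real_iff (hf.cons h) (dn_snd hx)))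
  env hf h := by
    rw [rel_ex_iff] at h ⊢
    exact ⟨h.1, hφ.env (hf.cons h.1.left) h.2⟩
  symm hf h := by
    rw [rel_ex_iff] at h ⊢
    exact ⟨h.1.symm, hφ.symm (hf.cons h.1.right) (hφ.env (hf.cons h.1) h.2)⟩
  trans hf h h' := by
    rw [rel_ex_iff] at h h' ⊢
    exact ⟨h.1.trans h'.1,
      hφ.trans (hf.cons h.1.left) h.2 (hφ.env (hf.cons h.1.symm) h'.2)⟩
  resp_left hf h e := by
    rw [rel_ex_iff] at h ⊢
    have e' := e.app_right h.1.1
    have hx := h.1.resp_left e'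
    exact ⟨hx, hφ.resp_left (hf.cons hx.left) (hφ.env (hf.cons (h.1.trans hx.symm)) h.2)
      (e.app_right h.2.1)⟩

/-! ### Disjunction -/

theorem Good.wk (hφ : φ.Good Γ) : φ.wk.Good (σ :: Γ) where
  same_subst _ g x y := hφ.same_subst _ g x y
  real_subst _ g x := hφ.real_subst _ g x
  real_iff hf := hφ.real_iff hf.tail
  env hf := hφ.env hf.tail
  symm hf := hφ.symm hf.tail
  trans hf := hφ.trans hf.tail
  resp_left hf := hφ.resp_left hf.tail

/-- The interpretation of `n = 0`, where `n` is the newest variable. -/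
abbrev isZero : Interp := atom fun f => .eq (f 0) .zero

/-- The interpretation of falsity. -/
abbrev falsum : Interp := atom fun _ => .bot

theorem good_isZero : isZero.Good (.nat :: Γ) :=
  good_atom (fun _ _ => rfl) fun hf h => (TyRel.nat_iff.1 (hf .nat .here)).symm.trans h

theorem good_falsum : falsum.Good Γ := good_atom (fun _ _ => rfl) fun _ h => h

theorem Good.or (hφ : φ.Good Γ) (hψ : ψ.Good Γ) : (φ.or ψ).Good Γ :=
  ((good_isZero.imp hφ.wk).and ((good_isZero.imp good_falsum).imp hψ.wk)).ex

end Interp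

/-- The atomic case `s = t` uses that typed terms send related environments to related values, which
is where the combinators and the recursor enter. -/
theorem interp_good {Γ : Ctx} (φ : HAomega.Formula Γ) : (interp φ).Good Γ := by
  induction φ with
  | bot => exact Interp.good_falsum
  | eq σ t u =>
    refine Interp.good_atom (fun f g => ?_) fun {H f f'} hf h => ?_
    · rw [sim_subst, tm_subst_right, tm_subst_right]
    · have ht := hf.tm t
      have hu := hf.tm u
      exact (ht.symm.trans (TyRel.trans ⟨ht.1, hu.1, h⟩ hu)).2.2
  | and _ _ ih₁ ih₂ => exact ih₁.and ih₂
  | or _ _ ih₁ ih₂ => exact ih₁.or ih₂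
  | imp _ _ ih₁ ih₂ => exact ih₁.imp ih₂
  | all σ _ ih => exact ih.all
  | ex σ _ ih => exact ih.ex

/-! ## Substitution in realizability formulas -/

theorem Comp.tail {Γ Δ : Ctx} {τ : Ty} {g : Sub Γ Δ} {f f' : ℕ → Term}
    (h : Comp (HAomega.up τ g) f f') : Comp g (fun n => f (n + 1)) (fun n => f' (n + 1)) :=
  fun σ v => (h σ (.there v)).trans
    (Comp.tm_subst (g := HAomega.wkSub Δ τ) (fun _ _ => rfl) (g σ v))

namespace Interp

/-- `I` is obtained from `J` by the typed substitution `g`. -/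
structure IsSubst {Γ Δ : Ctx} (g : Sub Γ Δ) (I J : Interp) : Prop where
  real {f f' : ℕ → Term} : Comp g f f' → ∀ x, I.real f x = J.real f' x
  same {f f' : ℕ → Term} : Comp g f f' → ∀ x y, I.same f x y = J.same f' x y

namespace IsSubst

variable {Γ Δ : Ctx} {σ : Ty} {g : Sub Γ Δ} {φ φ' ψ ψ' : Interp}

theorem atom {A A' : (ℕ → Term) → Formula} (h : ∀ f f', Comp g f f' → A f = A' f') :
    IsSubst g (.atom A) (.atom A') where
  real hf _ := h _ _ hf
  same hf x y := by simp only [Interp.atom, h _ _ hf]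

theorem and (hφ : IsSubst g φ φ') (hψ : IsSubst g ψ ψ') :
    IsSubst g (φ.and ψ) (φ'.and ψ') where
  real hf x := by simp only [Interp.and, hφ.real hf, hψ.real hf]
  same hf x y := by simp only [Interp.and, hφ.same hf, hψ.same hf]

theorem imp (hφ : IsSubst g φ φ') (hψ : IsSubst g ψ ψ') :
    IsSubst g (φ.imp ψ) (φ'.imp ψ') where
  real hf x := by
    simp only [Interp.imp, impReal, hφ.same hf.shift.shift, hψ.same hf.shift.shift]
  same hf x y := by
    simp only [Interp.imp, impReal, hφ.same hf.shift.shift, hψ.same hf.shift.shift,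
      hφ.real hf.shift, hψ.same hf.shift]

theorem all (hφ : IsSubst (HAomega.up σ g) φ φ') : IsSubst g (φ.all σ) (φ'.all σ) where
  real hf x := by simp only [Interp.all, allReal, hφ.same (hf.shift.shift.up _)]
  same hf x y := by
    simp only [Interp.all, allReal, hφ.same (hf.shift.shift.up _), hφ.same (hf.shift.up _)]

theorem ex (hφ : IsSubst (HAomega.up σ g) φ φ') : IsSubst g (φ.ex σ) (φ'.ex σ) where
  real hf x := by simp only [Interp.ex, hφ.real (hf.up _)]
  same hf x y := by simp only [Interp.ex, hφ.same (hf.up _)]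

theorem wk (hφ : IsSubst g φ φ') : IsSubst (HAomega.up σ g) φ.wk φ'.wk where
  real hf x := hφ.real hf.tail x
  same hf x y := hφ.same hf.tail x y

theorem or (hφ : IsSubst g φ φ') (hψ : IsSubst g ψ ψ') : IsSubst g (φ.or ψ) (φ'.or ψ') := by
  have h : IsSubst (HAomega.up .nat g) isZero isZero := atom fun f f' hf => by
    have := hf .nat .here
    exact congrArg (Formula.eq · .zero) this.symm
  exact ((h.imp hφ.wk).and ((h.imp (atom fun _ _ _ => rfl)).imp hψ.wk)).ex

end IsSubst

end Interp

/-- The two `HAP`-formulas coincide syntactically. `Comp` constrains assignments only at positions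
of the context, so it survives extension under binders. -/
theorem interp_subst {Γ Δ : Ctx} (φ : HAomega.Formula Γ) (g : Sub Γ Δ) :
    Interp.IsSubst g (interp (φ.subst g)) (interp φ) := by
  induction φ generalizing Δ with
  | bot => exact .atom fun _ _ _ => rfl
  | eq σ t u => exact .atom fun _ _ hf => by rw [hf.tm_subst, hf.tm_subst]
  | and _ _ ih₁ ih₂ => exact (ih₁ g).and (ih₂ g)
  | or _ _ ih₁ ih₂ => exact (ih₁ g).or (ih₂ g)
  | imp _ _ ih₁ ih₂ => exact (ih₁ g).imp (ih₂ g)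
  | all σ _ ih => exact (ih _).all
  | ex σ _ ih => exact (ih _).ex

theorem Comp.rel_subst {Γ Δ : Ctx} {g : Sub Γ Δ} {f f' : ℕ → Term} (hf : Comp g f f')
    {φ : HAomega.Formula Γ} {H : Formula} {x y : Term} :
    (interp (φ.subst g)).rel H f x y ↔ (interp φ).rel H f' x y := by
  simp only [Interp.rel, (interp_subst φ g).same hf]

theorem comp_inst {Γ : Ctx} {τ : Ty} (t : HAomega.Term Γ τ) (f : ℕ → Term) :
    Comp (HAomega.scons t fun _ v => .var v) f (scons (tm f t) f)
  | _, .here => rfl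
  | _, .there _ => rfl

/-! ## Construction of realizers -/

/-- The assignment of `0` to all variables. -/
abbrev zeros : ℕ → Term := fun _ => .zero

section

variable {H K : Formula} {g g' : ℕ → Term} {x y : Term}

/-- All values of the assignment denote. -/
def DnAll (H : Formula) (g : ℕ → Term) : Prop := ∀ n, Dn H (g n)

theorem dnAll_zeros : DnAll H zeros := fun _ => dn_const _

theorem DnAll.mono (h : DnAll H g) (hK : K ⊩ H) : DnAll K g := fun n => (h n).mono hK

theorem DnAll.cons (h : DnAll H g) (hx : Dn H x) : DnAll H (scons x g)
  | 0 => hx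
  | n + 1 => h n

theorem beta₂ (p : Poly) (hg : DnAll H g) (hx : Dn H x) (hy : Dn H y)
    (h : Dn H (p.eval (scons y (scons x g)))) :
    H ⊩ .eq (.app (.app (p.lam.lam.eval g) x) y) (p.eval (scons y (scons x g))) := by
  have h₁ := p.lam.beta hg hx (p.dn_lam (hg.cons hx))
  have h₂ := p.beta (hg.cons hx) hy h
  exact (h₁.symm.app_left h₂.dn_left).symm.trans h₂

namespace Interp

variable {Γ : Ctx} {σ τ : Ty} {f : ℕ → Term} {x' y' n : Term} {I φ ψ : Interp} {p q : Poly}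

theorem rel.app (h : (φ.imp ψ).rel H f x x') (hφ : φ.Good Γ) (hψ : ψ.Good Γ)
    (hf : EnvRel Γ H f f) (hy : φ.rel H f y y') : ψ.rel H f (.app x y) (.app x' y') :=
  ((rel_imp_iff hφ hψ hf).1 h).2.2 H .rfl y y' hy

theorem rel.app_all (h : (φ.all σ).rel H f x x') (hφ : φ.Good (σ :: Γ))
    (hf : EnvRel Γ H f f) (hy : TyRel σ H y y') :
    φ.rel H (scons y f) (.app x y) (.app x' y') :=
  ((rel_all_iff hφ hf).1 h).2.2 H .rfl y y' hy

/-- The introduction rule for implications: bodies need comparing only on related inputs, since beta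
reduction and invariance under equality do the rest. -/
theorem rel_lam_imp (hφ : φ.Good Γ) (hψ : ψ.Good Γ) (hf : EnvRel Γ H f f) (hg : DnAll H g)
    (hg' : DnAll H g') (h : ∀ K, K ⊩ H → ∀ y y', φ.rel K f y y' →
      ψ.rel K f (p.eval (scons y g)) (q.eval (scons y' g'))) :
    (φ.imp ψ).rel H f (p.lam.eval g) (q.lam.eval g') := by
  refine (rel_imp_iff hφ hψ hf).2 ⟨p.dn_lam hg, q.dn_lam hg', fun K hK y y' hy => ?_⟩
  have h' := h K hK y y' hy
  exact hψ.resp (hf.mono hK) h' (p.beta (hg.mono hK) hy.1 h'.1).symm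
    (q.beta (hg'.mono hK) hy.2.1 h'.2.1).symm

theorem rel_lam_all (hφ : φ.Good (σ :: Γ)) (hf : EnvRel Γ H f f) (hg : DnAll H g)
    (hg' : DnAll H g') (h : ∀ K, K ⊩ H → ∀ y y', TyRel σ K y y' →
      φ.rel K (scons y f) (p.eval (scons y g)) (q.eval (scons y' g'))) :
    (φ.all σ).rel H f (p.lam.eval g) (q.lam.eval g') := by
  refine (rel_all_iff hφ hf).2 ⟨p.dn_lam hg, q.dn_lam hg', fun K hK y y' hy => ?_⟩
  have h' := h K hK y y' hy
  exact hφ.resp ((hf.mono hK).cons hy.left) h' (p.beta (hg.mono hK) hy.1 h'.1).symm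
    (q.beta (hg'.mono hK) hy.2.1 h'.2.1).symm

theorem rel.pair (hx : φ.rel H f x x') (hy : ψ.rel H f y y') (hφ : φ.Good Γ) (hψ : ψ.Good Γ)
    (hf : EnvRel Γ H f f) : (φ.and ψ).rel H f (.pair x y) (.pair x' y') :=
  rel_and_iff.2 ⟨hφ.resp hf hx (ent_fst hx.1 hy.1).symm (ent_fst hx.2.1 hy.2.1).symm,
    hψ.resp hf hy (ent_snd hx.1 hy.1).symm (ent_snd hx.2.1 hy.2.1).symm⟩

theorem rel.ex (hy : φ.rel H (scons x f) y y') (hx : TyRel σ H x x') (hφ : φ.Good (σ :: Γ))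
    (hf : EnvRel Γ H f f) : (φ.ex σ).rel H f (.pair x y) (.pair x' y') := by
  -- In the target `φ` is evaluated at `p₀ (p x y)` instead of `x`; the environment is changed along
  -- this equation.
  have e := (ent_fst hx.1 hy.1).symm
  have hx' := hx.left.resp_right e
  exact rel_ex_iff.2 ⟨hx.resp e (ent_fst hx.2.1 hy.2.1).symm,
    hφ.resp (hf.cons hx'.right) (hφ.env (hf.cons hx') hy)
      (ent_snd hx.1 hy.1).symm (ent_snd hx.2.1 hy.2.1).symm⟩

/-- The formula expressing `I.rel`. -/
def relFormula (I : Interp) (f : ℕ → Term) (x y : Term) : Formula :=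
  .and (dn x) (.and (dn y) (I.same f x y))

theorem ent_relFormula : H ⊩ I.relFormula f x y ↔ I.rel H f x y := by
  simp only [relFormula, ent_and_iff, rel]

/-- The recursor realizes induction. -/
theorem rel.recur (hI : I.Good (.nat :: Γ)) (hf : EnvRel Γ H f f)
    (hx : I.rel H (scons .zero f) x x') (hy : Dn H y) (hy' : Dn H y')
    (hS : ∀ K t a a', K ⊩ H → Dn K t → I.rel K (scons t f) a a' →
      I.rel K (scons (.S t) f) (.app (.app y t) a) (.app (.app y' t) a'))
    (hn : Dn H n) : I.rel H (scons n f) (.recur x y n) (.recur x' y' n) := by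
  have inst (t : Term) : (I.relFormula (scons (.var 0) (shiftSub f))
      (.recur x.shift y.shift (.var 0)) (.recur x'.shift y'.shift (.var 0))).inst t =
        I.relFormula (scons t f) (.recur x y t) (.recur x' y' t) := by
    simp only [relFormula, Formula.inst, Formula.subst, hI.same_subst, Term.subst, scons_subst,
      shiftSub_subst_scons_var, Term.shift_subst_scons, Term.subst_var, scons_zero]
  rw [← ent_relFormula, ← inst]
  refine ent_ind ?_ (fun K t hK ht h => ?_) hn
  · rw [inst, ent_relFormula]
    exact hI.resp (hf.cons tyRel_zero) hx (ent_recur_zero hx.1 hy).symm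
      (ent_recur_zero hx.2.1 hy').symm
  · rw [inst, ent_relFormula] at h ⊢
    have h' := hS K t _ _ hK ht h
    exact hI.resp ((hf.mono hK).cons (TyRel.nat_iff.2 (dn_S ht))) h' (ent_recur_S h'.1).symm
      (ent_recur_S h'.2.1).symm

end Interp

end

/-! ## Environments as tuples -/

section

variable {Γ : Ctx} {σ τ : Ty} {H K : Formula} {f g : ℕ → Term} {e e' x y : Term}

/-- The projection of a tuple to its component at position `n`, counted from the right. -/
def proj : ℕ → Term → Term
  | 0, e => e.snd
  | n + 1, e => proj n e.fst

theorem proj_congr (h : H ⊩ .eq e e') (n : ℕ) : H ⊩ .eq (proj n e) (proj n e') := by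
  induction n generalizing e e' with
  | zero => exact h.app_right (dn_snd h.dn_left)
  | succ n ih => exact ih (h.app_right (dn_fst h.dn_left))

/-- The tuple `e` represents the assignment `f`. -/
def EnvRep (Γ : Ctx) (H : Formula) (e : Term) (f : ℕ → Term) : Prop :=
  Dn H e ∧ EnvRel Γ H f fun n => proj n e

theorem EnvRep.mono (h : EnvRep Γ H e f) (hK : K ⊩ H) : EnvRep Γ K e f :=
  ⟨h.1.mono hK, h.2.mono hK⟩

theorem EnvRep.env (h : EnvRep Γ H e f) : EnvRel Γ H f f := h.2.left

/-- Tuples represent assignments only up to `∼`, so tuples ending in different but related values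
can represent the same assignment. `Realizes.app_cons` depends on this freedom. -/
theorem EnvRep.cons (h : EnvRep Γ H e f) (hx : TyRel σ H x y) :
    EnvRep (σ :: Γ) H (.pair e y) (scons x f) := by
  refine ⟨dn_pair h.1 hx.2.1, fun ρ v => ?_⟩
  cases v with
  | here => exact hx.resp_right (ent_snd h.1 hx.2.1).symm
  | there v => exact (h.2 ρ v).resp_right (proj_congr (ent_fst h.1 hx.2.1).symm _)

/-- The polynomial computing the projection of a tuple. -/
def projPoly : ℕ → Poly → Poly
  | 0, e => e.snd
  | n + 1, e => projPoly n e.fst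

theorem eval_projPoly (n : ℕ) (p : Poly) (g : ℕ → Term) :
    (projPoly n p).eval g = HEO.proj n (p.eval g) := by
  induction n generalizing p with
  | zero => rfl
  | succ n ih => exact ih _

/-- The polynomial computing the value of a typed term from a tuple of values of its variables. -/
def tmPoly (e : Poly) : {σ : Ty} → HAomega.Term Γ σ → Poly
  | _, .var v => projPoly v.toNat e
  | _, .k _ _ => .const .k
  | _, .s _ _ _ => .const .s
  | _, .p _ _ => .const .p
  | _, .p0 _ _ => .const .p0
  | _, .p1 _ _ => .const .p1
  | _, .zero => .const .zero
  | _, .S => .const .succ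
  | _, .R _ => .const .r
  | _, .app t u => .app (tmPoly e t) (tmPoly e u)

theorem eval_tmPoly (e : Poly) (t : HAomega.Term Γ σ) (g : ℕ → Term) :
    (tmPoly e t).eval g = HEO.tm (fun n => HEO.proj n (e.eval g)) t := by
  induction t with
  | var v => exact eval_projPoly _ _ _
  | app _ _ ih₁ ih₂ => simp only [tmPoly, HAP.Poly.eval, HEO.tm, ih₁, ih₂]
  | _ => rfl

theorem EnvRep.tm {p : Poly} (h : EnvRep Γ H (p.eval g) f) (t : HAomega.Term Γ σ) :
    TyRel σ H (HEO.tm f t) ((tmPoly p t).eval g) := by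
  rw [eval_tmPoly]
  exact h.2.tm t

end

/-! ## Soundness -/

/-- The closed term `r` sends tuples of values of the variables to realizers of `φ`. -/
def Realizes {Γ : Ctx} (r : ClosedTerm) (φ : HAomega.Formula Γ) : Prop :=
  ∀ H f e e', EnvRep Γ H e f → EnvRep Γ H e' f →
    (interp φ).rel H f (.app r.term e) (.app r.term e')

/-- Some closed term realizes `φ`, uniformly in the variables of `φ`. -/
def Realizable {Γ : Ctx} (φ : HAomega.Formula Γ) : Prop := ∃ r, Realizes r φ

section

variable {Γ : Ctx} {σ τ : Ty} {H K : Formula} {f : ℕ → Term} {e e' x x' y y' : Term}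
  {φ ψ χ : HAomega.Formula Γ}

theorem EnvRep.dnAll (h : EnvRep Γ H e f) : DnAll H (scons e zeros) := dnAll_zeros.cons h.1

theorem Realizable.intro (p : Poly) (h : ∀ H f e e', EnvRep Γ H e f → EnvRep Γ H e' f →
    (interp φ).rel H f (p.eval (scons e zeros)) (p.eval (scons e' zeros))) : Realizable φ := by
  refine ⟨p.toClosed, fun H f e e' he he' => ?_⟩
  have h' := h H f e e' he he'
  exact (interp_good φ).resp he.env h' (p.beta dnAll_zeros he.1 h'.1).symm
    (p.beta dnAll_zeros he'.1 h'.2.1).symm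

/-- In `p`, index `0` is the realizer of the premise and index `1` the tuple of parameters. -/
theorem Realizable.intro_imp (p : Poly) (h : ∀ H f e e' x x', EnvRep Γ H e f → EnvRep Γ H e' f →
    (interp φ).rel H f x x' → (interp ψ).rel H f (p.eval (scons x (scons e zeros)))
      (p.eval (scons x' (scons e' zeros)))) : Realizable (.imp φ ψ) :=
  .intro p.lam fun _ _ _ _ he he' =>
    Interp.rel_lam_imp (interp_good φ) (interp_good ψ) he.env he.dnAll he'.dnAll
      fun _ hK _ _ hx => h _ _ _ _ _ _ (he.mono hK) (he'.mono hK) hx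

/-- Applying a realizer of an implication. -/
theorem Realizes.app {r : ClosedTerm} (hr : Realizes r (.imp φ ψ)) (he : EnvRep Γ H e f)
    (he' : EnvRep Γ H e' f) (hx : (interp φ).rel H f x x') :
    (interp ψ).rel H f (.app (.app r.term e) x) (.app (.app r.term e') x') :=
  (hr H f e e' he he').app (interp_good φ) (interp_good ψ) he.env hx

/-- Applying a realizer of an implication in an extended context. -/
theorem Realizes.app_cons {φ ψ : HAomega.Formula (σ :: Γ)} {r : ClosedTerm}
    (hr : Realizes r (.imp φ ψ)) (he : EnvRep Γ H e f) (he' : EnvRep Γ H e' f)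
    (hy : TyRel σ H y y') (hx : (interp φ).rel H (scons y f) x x') :
    (interp ψ).rel H (scons y f) (.app (.app r.term (.pair e y)) x)
      (.app (.app r.term (.pair e' y')) x') :=
  hr.app (he.cons hy.left) (he'.cons hy) hx

open Interp in
theorem Interp.rel_or_iff {φ ψ : Interp} : (φ.or ψ).rel H f x y ↔
    TyRel .nat H x.fst y.fst ∧ (isZero.imp φ.wk).rel H (scons x.fst f) x.snd.fst y.snd.fst ∧
      ((isZero.imp falsum).imp ψ.wk).rel H (scons x.fst f) x.snd.snd y.snd.snd :=
  rel_ex_iff.trans (and_congr_right' rel_and_iff)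

open Interp in
theorem Interp.rel.or {φ ψ : Interp} {m n x₁ x₁' x₂ x₂' : Term} (hm : TyRel .nat H m n)
    (h₁ : (isZero.imp φ.wk).rel H (scons m f) x₁ x₁')
    (h₂ : ((isZero.imp falsum).imp ψ.wk).rel H (scons m f) x₂ x₂')
    (hφ : φ.Good Γ) (hψ : ψ.Good Γ) (hf : EnvRel Γ H f f) :
    (φ.or ψ).rel H f (.pair m (.pair x₁ x₂)) (.pair n (.pair x₁' x₂')) :=
  have g₁ := good_isZero.imp hφ.wk
  have g₂ := (good_isZero.imp good_falsum).imp hψ.wk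
  (h₁.pair h₂ g₁ g₂ (hf.cons hm.left)).ex hm (g₁.and g₂) hf

/-! ### Definition by cases from the recursor -/

/-- Application is strict, so even a step function that ignores the previous value requires that
value to exist; totality of the step ensures this by induction. -/
theorem dn_recur {a b n : Term} (ha : Dn H a) (hb : Dn H b)
    (h : ∀ K m w, K ⊩ H → Dn K m → Dn K w → Dn K (.app (.app b m) w)) (hn : Dn H n) :
    Dn H (.recur a b n) := by
  have inst (t : Term) : (dn (.recur a.shift b.shift (.var 0))).inst t = dn (.recur a b t) := by
    simp [Formula.inst, Formula.subst, Term.subst]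
  rw [Dn, ← inst]
  refine ent_ind ?_ (fun K t hK ht hr => ?_) hn
  · rw [inst]
    exact (ent_recur_zero ha hb).dn_left
  · rw [inst] at hr ⊢
    exact (ent_recur_S (h K t _ hK ht hr)).dn_left

theorem ent_recur_of_eq_zero {a b n : Term} (ha : Dn H a) (hb : Dn H b)
    (hn : H ⊩ .eq n .zero) : H ⊩ .eq (.recur a b n) a :=
  (hn.symm.app_right (ent_recur_zero ha hb).dn_left).symm.trans (ent_recur_zero ha hb)

theorem ent_recur_of_eq_S {a b m n : Term} (ha : Dn H a) (hb : Dn H b)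
    (h : ∀ K m w, K ⊩ H → Dn K m → Dn K w → Dn K (.app (.app b m) w)) (hn : H ⊩ .eq n (.S m)) :
    H ⊩ .eq (.recur a b n) (.app (.app b m) (.recur a b m)) := by
  have hm : Dn H m := (Prov.strict_S m).ent_mp hn.dn_right
  have e := ent_recur_S (h H m _ .rfl hm (dn_recur ha hb h hm))
  exact (hn.symm.app_right e.dn_left).symm.trans e

/-- The polynomial that applies to `0` the function `p` if the value of `n` is `0`, and the
function `q` otherwise. -/
def casesPoly (p q n : Poly) : Poly :=
  -- Both branches are suspended by a dummy abstraction and released by the final argument `0`,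
  -- because the branch not taken need not denote. The outer two abstractions over `q` absorb the
  -- predecessor and the previous recursion value.
  .app (.app (.app (.app (.const .r) p.lam) q.lam.lam.lam) n) (.const .zero)

theorem ent_casesPoly_zero {p q n : Poly} {g : ℕ → Term} (hg : DnAll H g)
    (hn : H ⊩ .eq (n.eval g) .zero) (hp : Dn H (p.eval (scons .zero g))) :
    H ⊩ .eq ((casesPoly p q n).eval g) (p.eval (scons .zero g)) := by
  have e := p.beta hg (dn_const _) hp
  have e' := ent_recur_of_eq_zero (p.dn_lam hg) (q.lam.lam.dn_lam hg) hn
  exact (e'.symm.app_left e.dn_left).symm.trans e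

theorem ent_casesPoly_S {p q n : Poly} {g : ℕ → Term} {m : Term} (hg : DnAll H g)
    (hn : H ⊩ .eq (n.eval g) (.S m))
    (hq : ∀ w, Dn H w → Dn H (q.eval (scons .zero (scons w (scons m g))))) :
    ∃ w, Dn H w ∧
      H ⊩ .eq ((casesPoly p q n).eval g) (q.eval (scons .zero (scons w (scons m g)))) := by
  have hm : Dn H m := (Prov.strict_S m).ent_mp hn.dn_right
  have h : ∀ K m w, K ⊩ H → Dn K m → Dn K w →
      Dn K (.app (.app (q.lam.lam.lam.eval g) m) w) := fun K m w hK hm hw =>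
    (beta₂ q.lam (hg.mono hK) hm hw (q.dn_lam (((hg.mono hK).cons hm).cons hw))).dn_left
  have hw := dn_recur (p.dn_lam hg) (q.lam.lam.dn_lam hg) h hm
  refine ⟨_, hw, ?_⟩
  have e := ent_recur_of_eq_S (p.dn_lam hg) (q.lam.lam.dn_lam hg) h hn
  have hg' := (hg.cons hm).cons hw
  have e₂ := q.beta hg' (dn_const _) (hq _ hw)
  have e₁ := e.trans (beta₂ q.lam hg hm hw (q.dn_lam hg'))
  exact (e₁.symm.app_left e₂.dn_left).symm.trans e₂

theorem tyRel_of_rel_eq {t u : HAomega.Term Γ σ} (hf : EnvRel Γ H f f)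
    (h : (interp (.eq σ t u)).rel H f x x') : TyRel σ H (tm f t) (tm f u) :=
  ⟨(hf.tm t).1, (hf.tm u).1, (Interp.rel_atom_iff.1 h).1⟩

/-! ### Realizers for the propositional rules -/

namespace Realizable

theorem refl (φ : HAomega.Formula Γ) : Realizable (.imp φ φ) :=
  intro_imp (.var 0) fun _ _ _ _ _ _ _ _ hx => hx

theorem mp : Realizable φ → Realizable (.imp φ ψ) → Realizable ψ := by
  rintro ⟨r, hr⟩ ⟨s, hs⟩
  exact intro (.app (.app (.cl s) (.var 0)) (.app (.cl r) (.var 0))) fun H f e e' he he' =>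
    hs.app he he' (hr H f e e' he he')

theorem trans : Realizable (.imp φ ψ) → Realizable (.imp ψ χ) → Realizable (.imp φ χ) := by
  rintro ⟨r, hr⟩ ⟨s, hs⟩
  exact intro_imp (.app (.app (.cl s) (.var 1)) (.app (.app (.cl r) (.var 1)) (.var 0)))
    fun _ _ _ _ _ _ he he' hx => hs.app he he' (hr.app he he' hx)

theorem and_left (φ ψ : HAomega.Formula Γ) : Realizable (.imp (.and φ ψ) φ) :=
  intro_imp (.fst (.var 0)) fun _ _ _ _ _ _ _ _ hx => (Interp.rel_and_iff.1 hx).1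

theorem and_right (φ ψ : HAomega.Formula Γ) : Realizable (.imp (.and φ ψ) ψ) :=
  intro_imp (.snd (.var 0)) fun _ _ _ _ _ _ _ _ hx => (Interp.rel_and_iff.1 hx).2

theorem and_intro :
    Realizable (.imp φ ψ) → Realizable (.imp φ χ) → Realizable (.imp φ (.and ψ χ)) := by
  rintro ⟨r, hr⟩ ⟨s, hs⟩
  exact intro_imp (.pair (.app (.app (.cl r) (.var 1)) (.var 0))
    (.app (.app (.cl s) (.var 1)) (.var 0))) fun _ _ _ _ _ _ he he' hx =>
      (hr.app he he' hx).pair (hs.app he he' hx) (interp_good ψ) (interp_good χ) he.env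

theorem curry : Realizable (.imp (.and φ ψ) χ) → Realizable (.imp φ (.imp ψ χ)) := by
  rintro ⟨r, hr⟩
  refine intro_imp (Poly.lam (.app (.app (.cl r) (.var 2)) (.pair (.var 1) (.var 0))))
    fun H f e e' x x' he he' hx => ?_
  refine Interp.rel_lam_imp (interp_good ψ) (interp_good χ) he.env (he.dnAll.cons hx.1)
    (he'.dnAll.cons hx.2.1) fun K hK y y' hy => ?_
  exact hr.app (he.mono hK) (he'.mono hK)
    ((hx.mono hK).pair hy (interp_good φ) (interp_good ψ) (he.env.mono hK))

theorem uncurry : Realizable (.imp φ (.imp ψ χ)) → Realizable (.imp (.and φ ψ) χ) := by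
  rintro ⟨r, hr⟩
  refine intro_imp (.app (.app (.app (.cl r) (.var 1)) (.fst (.var 0))) (.snd (.var 0)))
    fun H f e e' x x' he he' hx => ?_
  obtain ⟨h₁, h₂⟩ := Interp.rel_and_iff.1 hx
  exact (hr.app he he' h₁).app (interp_good ψ) (interp_good χ) he.env h₂

theorem bot_elim (φ : HAomega.Formula Γ) : Realizable (.imp .bot φ) :=
  intro_imp (.var 0) fun _ _ _ _ _ _ _ _ hx =>
    Interp.rel_of_bot (Interp.rel_atom_iff.1 hx).1

/-! ### Quantifiers -/

theorem all_intro {ψ : HAomega.Formula (σ :: Γ)} :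
    Realizable (.imp (φ.wk σ) ψ) → Realizable (.imp φ (.all σ ψ)) := by
  rintro ⟨r, hr⟩
  -- Index `0` is the value of the new variable, `1` the realizer of `φ`, `2` the old tuple, which
  -- is extended before `r` is called.
  refine intro_imp (Poly.lam (.app (.app (.cl r) (.pair (.var 2) (.var 0))) (.var 1)))
    fun H f e e' x x' he he' hx => ?_
  refine Interp.rel_lam_all (interp_good ψ) he.env (he.dnAll.cons hx.1)
    (he'.dnAll.cons hx.2.1) fun K hK y y' hy => ?_
  exact hr.app_cons (he.mono hK) (he'.mono hK) hy
    ((comp_wkSub σ y f).rel_subst.2 (hx.mono hK))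

theorem all_elim (φ : HAomega.Formula (σ :: Γ)) (t : HAomega.Term Γ σ) :
    Realizable (.imp (.all σ φ) (φ.inst t)) := by
  refine intro_imp (.app (.var 0) (tmPoly (.var 1) t)) fun H f e e' x x' he he' hx => ?_
  have ht : TyRel σ H (tm f t) ((tmPoly (.var 1) t).eval (scons x (scons e zeros))) := he.tm t
  have ht' : TyRel σ H (tm f t) ((tmPoly (.var 1) t).eval (scons x' (scons e' zeros))) := he'.tm t
  exact (comp_inst t f).rel_subst.2 ((interp_good φ).env (he.env.cons ht.symm)
    (hx.app_all (interp_good φ) he.env (ht.symm.trans ht')))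

theorem ex_intro (φ : HAomega.Formula (σ :: Γ)) (t : HAomega.Term Γ σ) :
    Realizable (.imp (φ.inst t) (.ex σ φ)) := by
  refine intro_imp (.pair (tmPoly (.var 1) t) (.var 0)) fun H f e e' x x' he he' hx => ?_
  have ht : TyRel σ H (tm f t) ((tmPoly (.var 1) t).eval (scons x (scons e zeros))) := he.tm t
  have ht' : TyRel σ H (tm f t) ((tmPoly (.var 1) t).eval (scons x' (scons e' zeros))) := he'.tm t
  exact ((interp_good φ).env (he.env.cons ht) ((comp_inst t f).rel_subst.1 hx)).ex
    (ht.symm.trans ht') (interp_good φ) he.env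

theorem ex_elim {φ : HAomega.Formula (σ :: Γ)} :
    Realizable (.imp φ (ψ.wk σ)) → Realizable (.imp (.ex σ φ) ψ) := by
  rintro ⟨r, hr⟩
  refine intro_imp (.app (.app (.cl r) (.pair (.var 1) (.fst (.var 0)))) (.snd (.var 0)))
    fun H f e e' x x' he he' hx => ?_
  obtain ⟨h₁, h₂⟩ := Interp.rel_ex_iff.1 hx
  exact (comp_wkSub σ x.fst f).rel_subst.1 (hr.app_cons he he' h₁ h₂)

/-! ### Disjunction -/

open Interp in
theorem or_left (φ ψ : HAomega.Formula Γ) : Realizable (.imp φ (.or φ ψ)) := by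
  have gφ := interp_good φ
  have gψ := interp_good ψ
  refine intro_imp (.pair (.const .zero) (.pair (Poly.lam (.var 1)) (Poly.lam (.const .zero))))
    fun H f e e' x x' he he' hx => ?_
  have hf := he.env.cons (tyRel_zero (H := H))
  refine rel.or tyRel_zero ?_ ?_ gφ gψ he.env
  · exact rel_lam_imp good_isZero gφ.wk hf (he.dnAll.cons hx.1) (he'.dnAll.cons hx.2.1)
      fun K hK _ _ _ => hx.mono hK
  · refine rel_lam_imp (good_isZero.imp good_falsum) gψ.wk hf (he.dnAll.cons hx.1)
      (he'.dnAll.cons hx.2.1) fun K hK y y' hy => ?_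
    -- A realizer of `¬ 0 = 0`, applied to the realizer `0` of `0 = 0`, makes the world
    -- inconsistent.
    have h := hy.app good_isZero good_falsum (hf.mono hK)
      (rel_atom_iff.2 ⟨dn_const .zero, dn_const .zero⟩)
    exact rel_of_bot (rel_atom_iff.1 h).1

open Interp in
theorem or_right (φ ψ : HAomega.Formula Γ) : Realizable (.imp ψ (.or φ ψ)) := by
  have gφ := interp_good φ
  have gψ := interp_good ψ
  refine intro_imp (.pair (.app (.const .succ) (.const .zero))
    (.pair (Poly.lam (.const .zero)) (Poly.lam (.var 1)))) fun H f e e' x x' he he' hx => ?_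
  have h1 : TyRel .nat H (.app (.const .succ) .zero) (.app (.const .succ) .zero) :=
    tyRel_succ.app tyRel_zero
  have hf := he.env.cons h1
  refine rel.or h1 ?_ ?_ gφ gψ he.env
  · refine rel_lam_imp good_isZero gφ.wk hf (he.dnAll.cons hx.1) (he'.dnAll.cons hx.2.1)
      fun K hK y y' hy => ?_
    have h : K ⊩ .eq (.app (.const .succ) .zero) .zero := (rel_atom_iff.1 hy).1
    exact rel_of_bot (ent_zero_ne_S (h.symm.trans (ent_succ (dn_const _))))
  · exact rel_lam_imp (good_isZero.imp good_falsum) gψ.wk hf (he.dnAll.cons hx.1)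
      (he'.dnAll.cons hx.2.1) fun K hK _ _ _ => hx.mono hK

open Interp in
theorem or_elim : Realizable (.imp φ χ) → Realizable (.imp ψ χ) →
    Realizable (.imp (.or φ ψ) χ) := by
  rintro ⟨r, hr⟩ ⟨s, hs⟩
  have gφ := interp_good φ
  have gψ := interp_good ψ
  have gχ := interp_good χ
  -- The indices count the binders added by `casesPoly`: one above `p`, three above `q`. In both,
  -- index `0` takes the value `0`, which also realizes the guard `n = 0` or `¬ n = 0`.
  let p : Poly := .app (.app (.cl r) (.var 2)) (.app (.fst (.snd (.var 1))) (.var 0))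
  let q : Poly := .app (.app (.cl s) (.var 4)) (.app (.snd (.snd (.var 3))) (.var 0))
  let n : Poly := .fst (.var 0)
  refine intro_imp (casesPoly p q n) fun H f e e' x x' he he' hx => ?_
  obtain ⟨hn, h₁, h₂⟩ := rel_or_iff.1 hx
  -- Internalizing the relation as one formula makes the case distinction inside `HAP` applicable.
  rw [← ent_relFormula]
  refine ent_nat_cases hn.1 (fun K hK h0 => ?_) fun K m hK hS => ?_
  · rw [ent_relFormula]
    have hfK := he.env.mono hK
    have hnK := TyRel.nat_iff.1 (hn.mono hK)
    have h := hr.app (he.mono hK) (he'.mono hK) ((h₁.mono hK).app good_isZero gφ.wk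
      (hfK.cons (hn.mono hK).left) (rel_atom_iff.2 ⟨h0, dn_const .zero⟩))
    exact gχ.resp hfK h
      (ent_casesPoly_zero (p := p) (q := q) (n := n) ((he.dnAll.cons hx.1).mono hK) h0 h.1).symm
      (ent_casesPoly_zero (p := p) (q := q) (n := n) ((he'.dnAll.cons hx.2.1).mono hK)
        (hnK.symm.trans h0) h.2.1).symm
  · rw [ent_relFormula]
    have hfK := he.env.mono hK
    have hfn := hfK.cons (hn.mono hK).left
    have hnK := TyRel.nat_iff.1 (hn.mono hK)
    -- Any denoting term would do, since at these worlds a realizer of `n = 0` contradicts `n = S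
    -- m`.
    have hz : (isZero.imp falsum).rel K (scons x.fst f) .zero .zero :=
      (rel_imp_iff good_isZero good_falsum hfn).2 ⟨dn_const _, dn_const _,
        fun L hL y y' hy => rel_of_bot (ent_zero_ne_S
          ((rel_atom_iff.1 hy).1.symm.trans (hS.mono hL)))⟩
    have h := hs.app (he.mono hK) (he'.mono hK) ((h₂.mono hK).app
      (good_isZero.imp good_falsum) gψ.wk hfn hz)
    obtain ⟨w, -, hw⟩ :=
      ent_casesPoly_S (p := p) (q := q) (n := n) ((he.dnAll.cons hx.1).mono hK) hS fun _ _ => h.1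
    obtain ⟨w', -, hw'⟩ :=
      ent_casesPoly_S (p := p) (q := q) (n := n) ((he'.dnAll.cons hx.2.1).mono hK)
        (hnK.symm.trans hS) fun _ _ => h.2.1
    exact gχ.resp hfK h hw.symm hw'.symm

/-! ### Equality, successor and induction -/

/-- A realizer of an equation carries no information, so the constant `0` is always available. -/
theorem eq_intro {t u : HAomega.Term Γ σ}
    (h : ∀ H f, EnvRel Γ H f f → TyRel σ H (tm f t) (tm f u)) : Realizable (.eq σ t u) :=
  intro (.const .zero) fun H f _ _ he _ =>
    Interp.rel_atom_iff.2 ⟨(h H f he.env).2.2, dn_const _⟩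

theorem imp_eq_intro {t u : HAomega.Term Γ σ}
    (h : ∀ H f x x', EnvRel Γ H f f → (interp φ).rel H f x x' → TyRel σ H (tm f t) (tm f u)) :
    Realizable (.imp φ (.eq σ t u)) :=
  intro_imp (.const .zero) fun H f _ _ x x' he _ hx =>
    Interp.rel_atom_iff.2 ⟨(h H f x x' he.env hx).2.2, dn_const _⟩

theorem S_ne_zero (t : HAomega.Term Γ .nat) : Realizable (.neg (.eq .nat (.app .S t) .zero)) :=
  intro_imp (.const .zero) fun H f _ _ x x' he _ hx => by
    have h := TyRel.nat_iff.1 (tyRel_of_rel_eq he.env hx)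
    exact Interp.rel_of_bot (ent_zero_ne_S (h.symm.trans (ent_succ (he.env.tm t).1)))

theorem S_inj (t u : HAomega.Term Γ .nat) :
    Realizable (.imp (.eq .nat (.app .S t) (.app .S u)) (.eq .nat t u)) :=
  imp_eq_intro fun H f x x' hf hx => TyRel.nat_iff.2 <| by
    have h := TyRel.nat_iff.1 (tyRel_of_rel_eq hf hx)
    exact ent_S_inj ((ent_succ (hf.tm t).1).symm.trans (h.trans (ent_succ (hf.tm u).1)))

theorem ind (φ : HAomega.Formula (.nat :: Γ)) : Realizable (.imp (φ.inst .zero)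
    (.imp (.all .nat (.imp φ
        (φ.subst (HAomega.scons (.app .S (.var .here)) (HAomega.wkSub Γ .nat)))))
      (.all .nat φ))) := by
  have gφ := interp_good φ
  refine intro_imp (Poly.lam (Poly.lam
    (.app (.app (.app (.const .r) (.var 2)) (.var 1)) (.var 0))))
    fun H f e e' a a' he he' ha => ?_
  refine Interp.rel_lam_imp (interp_good _) gφ.all he.env (he.dnAll.cons ha.1)
    (he'.dnAll.cons ha.2.1) fun K hK b b' hb => ?_
  replace ha := ha.mono hK
  replace he := he.mono hK
  replace he' := he'.mono hK
  refine Interp.rel_lam_all gφ he.env ((he.dnAll.cons ha.1).cons hb.1)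
    ((he'.dnAll.cons ha.2.1).cons hb.2.1) fun L hL n n' hn => ?_
  replace ha := (comp_inst .zero f).rel_subst.1 (ha.mono hL)
  replace hb := hb.mono hL
  have hfL := he.env.mono hL
  have h := ha.recur gφ hfL hb.1 hb.2.1 (fun K' t x x' hK' ht hx => ?_) hn.1
  · exact gφ.resp (hfL.cons hn.left) h h.1 ((TyRel.nat_iff.1 hn).app_right h.2.1)
  · have ht' : TyRel .nat K' t t := TyRel.nat_iff.2 ht
    have hfK := hfL.mono hK'
    have h := ((hb.mono hK').app_all (gφ.imp (interp_good _)) hfK ht').app gφ (interp_good _)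
      (hfK.cons ht') hx
    have hc : Comp (HAomega.scons (.app .S (.var .here)) (HAomega.wkSub Γ .nat)) (scons t f)
        (scons (.app (.const .succ) t) f) := fun σ v => by cases v <;> rfl
    -- The typed successor is read as `succ · t`, whereas the induction of `HAP` proceeds to `S t`.
    exact gφ.env (hfK.cons (TyRel.nat_iff.2 (ent_succ ht))) (hc.rel_subst.1 h)

/-! ### Extensionality and choice -/

/-- A realizer of the premise already yields `a z ∼ b z` for all `z` in HEO; as `b` respects `∼`,
this is `a ∼ b`. The realizer itself is constant. -/
theorem ext (σ τ : Ty) : Realizable (Γ := Γ)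
    (.all (.arrow σ τ) (.all (.arrow σ τ) (.imp
      (.all σ (.eq τ (.app (.var (.there (.there .here))) (.var .here))
        (.app (.var (.there .here)) (.var .here))))
      (.eq (.arrow σ τ) (.var (.there .here)) (.var .here))))) := by
  refine intro (Poly.lam (Poly.lam (Poly.lam (.const .zero)))) fun H f e e' he he' => ?_
  refine Interp.rel_lam_all (interp_good _) he.env he.dnAll he'.dnAll fun H₁ h₁ a a' ha => ?_
  have hf₁ := (he.env.mono h₁).cons ha.left
  refine Interp.rel_lam_all (interp_good _) hf₁ ((he.dnAll.mono h₁).cons ha.1)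
    ((he'.dnAll.mono h₁).cons ha.2.1) fun H₂ h₂ b b' hb => ?_
  have hf₂ := (hf₁.mono h₂).cons hb.left
  replace ha := ha.mono h₂
  refine Interp.rel_lam_imp (interp_good _) (interp_good _) hf₂
    (((he.dnAll.mono h₁).mono h₂).cons ha.1 |>.cons hb.1)
    (((he'.dnAll.mono h₁).mono h₂).cons ha.2.1 |>.cons hb.2.1) fun H₃ h₃ x x' hx => ?_
  refine Interp.rel_atom_iff.2 ⟨?_, dn_const _⟩
  suffices h : TyRel (.arrow σ τ) H₃ a b from h.2.2
  refine TyRel.arrow_iff.2 ⟨ha.1.mono h₃, hb.1.mono h₃, fun K hK z z' hz => ?_⟩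
  have hfK := (hf₂.mono h₃).mono hK
  have h := tyRel_of_rel_eq (hfK.cons hz.left) ((hx.mono hK).app_all (interp_good _) hfK hz)
  exact TyRel.trans h (((hb.left.mono h₃).mono hK).app hz)

/-- A realizer `a` of the premise splits into `F = λ x. p₀ (a x)` and `λ x. p₁ (a x)`.
Extensionality of `a` makes `F` an object of HEO, as the existential quantifier over functions
demands. -/
theorem choice (σ τ : Ty) (φ : HAomega.Formula (τ :: σ :: Γ)) : Realizable
    (.imp (.all σ (.ex τ φ)) (.ex (.arrow σ τ) (.all σ (φ.subst
      (HAomega.scons (.app (.var (.there .here)) (.var .here))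
        (HAomega.scons (.var .here) (fun _ v => .var (.there (.there v))))))))) := by
  have gφ := interp_good φ
  refine intro_imp (.pair (Poly.lam (.fst (.app (.var 1) (.var 0))))
    (Poly.lam (.snd (.app (.var 1) (.var 0))))) fun H f e e' a a' he he' ha => ?_
  set F := (Poly.lam (.fst (.app (.var 1) (.var 0)))).eval (scons a (scons e zeros))
  set F' := (Poly.lam (.fst (.app (.var 1) (.var 0)))).eval (scons a' (scons e' zeros))
  have hg := he.dnAll.cons ha.1
  have hg' := he'.dnAll.cons ha.2.1
  have key (K : Formula) (hK : K ⊩ H) (y y' : Term) (hy : TyRel σ K y y') :=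
    Interp.rel_ex_iff.1 ((ha.mono hK).app_all gφ.ex (he.env.mono hK) hy)
  have beta (K : Formula) (hK : K ⊩ H) (y y' : Term) (hy : TyRel σ K y y') :
      K ⊩ .eq (.app F y) (Term.app a y).fst :=
    Poly.beta (.fst (.app (.var 1) (.var 0))) (hg.mono hK) hy.1 (key K hK y y' hy).1.1
  have beta' (K : Formula) (hK : K ⊩ H) (y y' : Term) (hy : TyRel σ K y y') :
      K ⊩ .eq (.app F' y') (Term.app a' y').fst :=
    Poly.beta (.fst (.app (.var 1) (.var 0))) (hg'.mono hK) hy.2.1 (key K hK y y' hy).1.2.1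
  have hFF : TyRel (.arrow σ τ) H F F' :=
    TyRel.arrow_iff.2 ⟨Poly.dn_lam _ hg, Poly.dn_lam _ hg', fun K hK y y' hy =>
      (key K hK y y' hy).1.resp (beta K hK y y' hy).symm (beta' K hK y y' hy).symm⟩
  refine Interp.rel.ex ?_ hFF (interp_good _) he.env
  refine Interp.rel_lam_all (interp_good _) (he.env.cons hFF.left) hg hg' fun K hK y y' hy => ?_
  have hc : Comp (Γ := τ :: σ :: Γ) (Δ := σ :: .arrow σ τ :: Γ)
      (HAomega.scons (.app (.var (.there .here)) (.var .here))
      (HAomega.scons (.var .here) (fun _ v => .var (.there (.there v)))))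
      (scons y (scons F f)) (scons (.app F y) (scons y f)) := by
    intro ρ v
    cases v with
    | here => rfl
    | there v => cases v <;> rfl
  refine hc.rel_subst.2 ?_
  obtain ⟨h₁, h₂⟩ := key K hK y y' hy
  -- The premise realizes `φ` at `p₀ (a y)`, the conclusion needs it at `F y`; these are equal by
  -- beta reduction.
  exact gφ.env (((he.env.mono hK).cons hy.left).cons
    (h₁.left.resp_right (beta K hK y y' hy).symm)) h₂

end Realizable

end

/-- Extensional realizability is sound for intuitionistic arithmetic in all finite types with
extensionality and choice. -/
theorem soundness {Γ : Ctx} {φ : HAomega.Formula Γ} (h : HAomega.Prov HAomega.ExtAC φ) :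
    Realizable φ := by
  induction h with
  | ax h =>
    cases h with
    | ext σ τ => exact .ext σ τ
    | ac σ τ φ => exact .choice σ τ φ
  | refl φ => exact .refl φ
  | mp _ _ ih₁ ih₂ => exact .mp ih₁ ih₂
  | trans _ _ ih₁ ih₂ => exact .trans ih₁ ih₂
  | and_left φ ψ => exact .and_left φ ψ
  | and_right φ ψ => exact .and_right φ ψ
  | and_intro _ _ ih₁ ih₂ => exact .and_intro ih₁ ih₂
  | or_left φ ψ => exact .or_left φ ψ
  | or_right φ ψ => exact .or_right φ ψ
  | or_elim _ _ ih₁ ih₂ => exact .or_elim ih₁ ih₂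
  | curry _ ih => exact .curry ih
  | uncurry _ ih => exact .uncurry ih
  | bot_elim φ => exact .bot_elim φ
  | all_intro _ ih => exact .all_intro ih
  | all_elim φ t => exact .all_elim φ t
  | ex_intro φ t => exact .ex_intro φ t
  | ex_elim _ ih => exact .ex_elim ih
  | eq_refl t => exact .eq_intro fun H f hf => hf.tm t
  | eq_symm t u => exact .imp_eq_intro fun H f x x' hf h => (tyRel_of_rel_eq hf h).symm
  | eq_trans t u v =>
    refine .imp_eq_intro fun H f x x' hf h => ?_
    obtain ⟨h₁, h₂⟩ := Interp.rel_and_iff.1 h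
    exact (tyRel_of_rel_eq hf h₁).trans (tyRel_of_rel_eq hf h₂)
  | eq_fun t u v =>
    exact .imp_eq_intro fun H f x x' hf h => (tyRel_of_rel_eq hf h).app (hf.tm v)
  | eq_arg t u v =>
    exact .imp_eq_intro fun H f x x' hf h => (hf.tm t).app (tyRel_of_rel_eq hf h)
  | S_ne_zero t => exact .S_ne_zero t
  | S_inj t u => exact .S_inj t u
  | ind φ => exact .ind φ
  | k_eq t u =>
    exact .eq_intro fun H f hf => (hf.tm t).resp_left (ent_k (hf.tm t).1 (hf.tm u).1).symm
  | s_eq t u v =>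
    refine .eq_intro fun H f hf => ?_
    have h := hf.tm (.app (.app t v) (.app u v))
    exact h.resp_left (ent_s (hf.tm t).1 (hf.tm u).1 h.1).symm
  | p0_eq t u =>
    exact .eq_intro fun H f hf => (hf.tm t).resp_left (ent_fst (hf.tm t).1 (hf.tm u).1).symm
  | p1_eq t u =>
    exact .eq_intro fun H f hf => (hf.tm u).resp_left (ent_snd (hf.tm t).1 (hf.tm u).1).symm
  | p_eq t => exact .eq_intro fun H f hf => (hf.tm t).resp_left (ent_pair (hf.tm t).1).symm
  | R_zero t u =>
    exact .eq_intro fun H f hf =>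
      (hf.tm t).resp_left (ent_recur_zero (hf.tm t).1 (hf.tm u).1).symm
  | R_S t u n =>
    refine .eq_intro fun H f hf => ?_
    have h := hf.tm (.app (.app u n) (.app (.app (.app (.R _) t) u) n))
    have e := ent_recur_S h.1
    exact h.resp_left (((ent_succ (hf.tm n).1).symm.app_right e.dn_left).symm.trans e).symm

/-! ## Currying -/

section

variable {Γ : Ctx} {H : Formula} {f g : ℕ → Term} {x y : Term}

/-- The application of `x` to the terms that `f` assigns to the variables of a context. -/
def appEnv : Ctx → Term → (ℕ → Term) → Term
  | [], x, _ => x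
  | _ :: Γ, x, f => .app (appEnv Γ x fun n => f (n + 1)) (f 0)

/-- The tuple of the terms that `f` assigns to the variables of a context. -/
def tuple : Ctx → (ℕ → Term) → Term
  | [], _ => .zero
  | _ :: Γ, f => .pair (tuple Γ fun n => f (n + 1)) (f 0)

theorem EnvRel.tuple : {Γ : Ctx} → {f : ℕ → Term} → EnvRel Γ H f f → EnvRep Γ H (tuple Γ f) f
  | [], _, _ => ⟨dn_const _, fun _ v => nomatch v⟩
  | σ :: Γ, f, h => by
    have h' := h.tail.tuple.cons (h σ .here)
    refine ⟨h'.1, fun ρ v => ?_⟩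
    have := h'.2 ρ v
    cases v <;> exact this

/-- The polynomial `λ e y. r (e, y)`. -/
abbrev curryPoly (r : ClosedTerm) : Poly :=
  Poly.lam (.app (.cl r) (.pair (.var 1) (.var 0)))

/-- The curried form of a closed term that expects a tuple. -/
def curried : Ctx → ClosedTerm → Term
  | [], r => .app r.term .zero
  | _ :: Γ, r => curried Γ (curryPoly r).toClosed

theorem curried_subst (Γ : Ctx) (r : ClosedTerm) : (curried Γ r).subst f = curried Γ r := by
  induction Γ generalizing r with
  | nil => simp [curried, Term.subst, r.subst_term]
  | cons σ Γ ih => exact ih _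

theorem ent_curryPoly (r : ClosedTerm) (hx : Dn H x) :
    H ⊩ .eq (.app (curryPoly r).toClosed.term x) ((curryPoly r).eval (scons x zeros)) :=
  (curryPoly r).beta dnAll_zeros hx (Poly.dn_lam _ (dnAll_zeros.cons hx))

theorem dn_curried (Γ : Ctx) {r : ClosedTerm} (h : Dn H (.app r.term .zero)) :
    Dn H (curried Γ r) := by
  induction Γ generalizing r with
  | nil => exact h
  | cons σ Γ ih => exact ih (ent_curryPoly r (dn_const _)).dn_left

/-- With at least one variable the term denotes because abstractions do; with none it is the
application of `r` to the empty tuple, which exists because `r` realizes `φ`. -/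
theorem dn_curried_of_realizes {φ : HAomega.Formula Γ} {r : ClosedTerm} (hr : Realizes r φ) :
    Dn H (curried Γ r) := by
  cases Γ with
  | nil =>
    have h : EnvRel [] H zeros zeros := fun _ v => nomatch v
    exact (hr H _ _ _ h.tuple h.tuple).1
  | cons σ Γ => exact dn_curried Γ (ent_curryPoly r (dn_const _)).dn_left

/-- Each step peels off the newest variable, which is the last argument and the right end of the
tuple, and replaces `r` by `λ e y. r (e, y)`. -/
theorem ent_appEnv_curried {Γ : Ctx} {f : ℕ → Term} (r : ClosedTerm) (hf : EnvRel Γ H f f)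
    (h : Dn H (.app r.term (tuple Γ f))) :
    H ⊩ .eq (appEnv Γ (curried Γ r) f) (.app r.term (tuple Γ f)) := by
  induction Γ generalizing r f with
  | nil => exact h
  | cons σ Γ ih =>
    have ht := hf.tail.tuple.1
    have e := ent_curryPoly r ht
    have e₁ := (ih (curryPoly r).toClosed hf.tail e.dn_left).trans e
    have e₂ := Poly.beta (.app (.cl r) (.pair (.var 1) (.var 0))) (dnAll_zeros.cons ht)
      (hf σ .here).1 h
    exact (e₁.symm.app_left e₂.dn_left).symm.trans e₂

/-! ## Blocks of quantifiers -/

/-- The extension of a substitution under `n` binders. -/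
def upN : ℕ → (ℕ → Term) → ℕ → Term
  | 0, f => f
  | n + 1, f => up (upN n f)

theorem allN_subst (n : ℕ) (φ : Formula) (f : ℕ → Term) :
    (Formula.allN n φ).subst f = Formula.allN n (φ.subst (upN n f)) := by
  induction n generalizing φ with
  | zero => rfl
  | succ n ih => exact ih _

theorem prov_allN {φ : Formula} (h : Prov φ) (n : ℕ) : Prov (Formula.allN n φ) := by
  induction n generalizing φ with
  | zero => exact h
  | succ n ih => exact ih h.gen

theorem upN_of_lt (f : ℕ → Term) {n i : ℕ} (h : i < n) : upN n f i = .var i := by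
  induction n generalizing i with
  | zero => omega
  | succ n ih =>
    cases i with
    | zero => rfl
    | succ i => simp [upN, shiftSub, ih (Nat.lt_of_succ_lt_succ h), Term.shift, Term.subst]

theorem upN_self (hx : ∀ g, x.subst g = x) (f : ℕ → Term) (n : ℕ) :
    upN n (scons x f) n = x := by
  induction n with
  | zero => rfl
  | succ n ih => simp [upN, shiftSub, ih, Term.shift, hx]

theorem appCtx_subst (Γ : Ctx) (i : ℕ) (g : ℕ → Term) :
    (appCtx Γ i).subst g = appEnv Γ (g (i + Γ.length)) fun n => g (i + n) := by
  induction Γ generalizing i with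
  | nil => rfl
  | cons σ Γ ih => simp [appCtx, appEnv, Term.subst, ih, Nat.add_assoc, Nat.add_comm 1]

theorem envRel_of_heoCtx (i : ℕ) (hg : ∀ n < Γ.length, Dn H (g (i + n)))
    (h : H ⊩ (heoCtx Γ i).subst g) : EnvRel Γ H (fun n => g (i + n)) fun n => g (i + n) := by
  induction Γ generalizing i with
  | nil => exact fun _ v => nomatch v
  | cons σ Γ ih =>
    obtain ⟨h₁, h₂⟩ := ent_and_iff.1 h
    have hg' (n : ℕ) : g (i + 1 + n) = g (i + (n + 1)) := by rw [Nat.add_right_comm]; rfl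
    have := ih (i + 1) (fun n hn => hg' n ▸ hg (n + 1) (Nat.succ_lt_succ hn)) h₁
    simp only [hg'] at this
    rw [heo, sim_subst] at h₂
    have h0 := hg 0 (Nat.succ_pos _)
    intro ρ v
    cases v with
    | here => exact ⟨h0, h0, h₂⟩
    | there v => exact this ρ v

end

end HEO

/-! ### The main theorem -/

theorem mainTheorem8 (Γ : HAomega.Ctx) (φ : HAomega.Formula Γ)
    (h : HAomega.Prov HAomega.ExtAC φ) :
    HAP.Prov (HEO.realizable φ) := by
  open HAP HEO in
  obtain ⟨r, hr⟩ := soundness h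
  have hc : ∀ f, (curried Γ r).subst f = curried Γ r := fun f => curried_subst Γ r
  refine .mp (.mp (.refl .bot) (ent_and_iff.2 ⟨?_, dn_curried_of_realizes hr⟩))
    (.ex_intro _ (curried Γ r))
  rw [Formula.inst, allN_subst]
  refine (prov_allN ?_ _).ent
  -- Under the quantifier block, this substitution fixes the bound variables and puts the closed
  -- witness for `x` at index `Γ.length`.
  set g := upN Γ.length (scons (curried Γ r) .var)
  have hlt (n : ℕ) (hn : n < Γ.length) : g n = .var n := upN_of_lt _ hn
  have hself : g Γ.length = curried Γ r := upN_self hc _ _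
  change (heoCtx Γ 0).subst g ⊩ .and (.dn ((appCtx Γ 0).subst g)) _
  -- The hypothesis on the variables becomes the world; at it the variables form an environment
  -- related to itself.
  generalize hH : (heoCtx Γ 0).subst g = H
  have hf : EnvRel Γ H g g := by
    have := envRel_of_heoCtx (Γ := Γ) (H := H) (g := g) 0
      (fun n hn => by rw [Nat.zero_add, hlt n hn]; exact dn_var n) (hH ▸ .rfl)
    simpa only [Nat.zero_add] using this
  have hrel := hr H g _ _ hf.tuple hf.tuple
  have e := (ent_appEnv_curried r hf hrel.1).symm
  have hx := (interp_good φ).resp hf hrel e e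
  have happ : (appCtx Γ 0).subst g = appEnv Γ (curried Γ r) g := by
    rw [appCtx_subst, Nat.zero_add, hself]
    simp only [Nat.zero_add]
  refine ent_and_iff.2 ⟨happ ▸ hx.1, ?_⟩
  rw [realizes, (interp_good φ).real_subst, happ]
  exact ((interp_good φ).real_iff hf hx.1).2 hx
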